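/- Let $p$ be an odd prime, $q$ a power of $p$, and $\mathbb{F}$ an algebraic closure of $\mathbb{F}_q$. For a field $k$ let $\mathscr{A}_k$ be the set of additive polynomials over $k$, i.e. $g\in k[x]$ with $g(x+y)=g(x)+g(y)$. Let $R(x)=\sum_{i=0}^e a_i x^{p^i}\in\mathscr{A}_{\mathbb{F}_q}$ with $a_e\neq 0$, and let $m$ be a positive integer prime to $p$. Put $$E_R(x)=R(x)^{p^e}+\sum_{i=0}^e (a_ix)^{p^{e-i}},\qquad f_R(x,y)=-\sum_{i=0}^{e-1}\Bigl(\sum_{j=0}^{e-i-1}(a_ix^{p^i}y)^{p^j}+(xR(y))^{p^i}\Bigr),$$ $d_R=\gcd\{p^i+1\mid a_i\neq 0\}$ and $d_{R,m}=d_R/\gcd(d_R,m)$ (and define $d_{R_1}$ in the same way for a non-zero $R_1\in\mathscr{A}_{\mathbb{F}}$). For $n\geq 1$ let $\mu_n=\{\alpha\in\mathbb{F}\mid\alpha^n=1\}$. Let $V_R=\{\beta\in\mathbb{F}\mid E_R(\beta)=0\}$, an $\mathbb{F}_p$-vector space with the symplectic form $\omega_R(\beta,\beta')=f_R(\beta,\beta')-f_R(\beta',\beta)\in\mathbb{F}_p$.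 The group $\mathscr{H}=\mu_{d_{R,m}}\rtimes\mathbb{Z}/r\mathbb{Z}$ acts on $V_R$: $\alpha\in\mu_{d_{R,m}}$ by $x\mapsto\alpha x$, and the generator $\sigma$ of $\mathbb{Z}/r\mathbb{Z}$ by $x\mapsto x^q$ (here $r\ge 1$ is such that $\sigma^r$ acts trivially on $V_R$ and on $\mu_{d_{R,m}}$); so an $\mathbb{F}_p[\mathscr{H}]$-submodule of $V_R$ is an $\mathbb{F}_p$-subspace stable under $x\mapsto x^q$ and under multiplication by $\mu_{d_{R,m}}$. The module $(V_R,\omega_R)$ is called completely anisotropic if it has no non-zero totally isotropic $\mathbb{F}_p[\mathscr{H}]$-submodule. Let $H_R$ be the group of triples $(1,\beta,\gamma)$ with $\beta\in V_R$, $\gamma\in\mathbb{F}$, $\gamma^p-\gamma=\beta R(\beta)$, with multiplication $(1,\beta_1,\gamma_1)(1,\beta_2,\gamma_2)=(1,\beta_1+\beta_2,\gamma_1+\gamma_2+f_R(\beta_1,\beta_2))$. For $P\in\mathscr{A}_{\mathbb{F}}$ let $C_{P,\mathbb{F}}$ be the affine curve $a^p-a=xP(x)$ over $\mathbb{F}$.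 The group $H_R$ acts on $C_{R,\mathbb{F}}$ from the right by $(a,x)\cdot(1,\beta,\gamma)=(a+f_R(x,\beta)+\gamma,\,x+\beta)$. **Proposition.** Assume that $(V_R,\omega_R)$ is not completely anisotropic, and let $U_R\subset V_R$ be any non-zero totally isotropic $\mathbb{F}_p[\mathscr{H}]$-submodule. Then: (i) There is a monic reduced $r(x)\in\mathscr{A}_{\mathbb{F}}$ whose set of zeros in $\mathbb{F}$ is $U_R$; it lies in $\mathbb{F}_q[x]$, satisfies $r(\alpha x)=\alpha r(x)$ for all $\alpha\in\mu_{d_{R,m}}$, and $\deg r=p^{e-e'}$ for an integer $0\leq e'<e$ with $\dim_{\mathbb{F}_p}U_R=e-e'$. (ii) Let $\beta_1,\dots,\beta_{e-e'}$ be any $\mathbb{F}_p$-basis of $U_R$, put $\gamma_i=f_R(\beta_i,\beta_i)/2$, so that $(1,\beta_i,\gamma_i)\in H_R$, and let $U_i=\{(1,\xi\beta_i,\xi^2\gamma_i)\mid\xi\in\mathbb{F}_p\}$. The product $U'_R=U_1\cdots U_{e-e'}$ is an abelian subgroup of $H_R$. (iii) There exist $R_1(x)\in\mathscr{A}_{\mathbb{F}}$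 of degree $p^{e'}$ and $\Delta(x)\in\mathbb{F}[x]$ with $\Delta(0)=0$ such that $$xR(x)=r(x)R_1(r(x))+\Delta(x)^p-\Delta(x),$$ and the morphism $\pi\colon C_{R,\mathbb{F}}\to C_{R_1,\mathbb{F}}$, $(a,x)\mapsto(a-\Delta(x),r(x))$, induces an isomorphism $C_{R,\mathbb{F}}/U'_R\cong C_{R_1,\mathbb{F}}$ over $\mathbb{F}$. Furthermore, $d_{R,m}\mid d_{R_1}$. -/

import Mathlib

set_option linter.unusedSectionVars false

open Polynomial
open scoped Pointwise

universe u v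

/-! ### Additive polynomials -/

/-- `f ∈ K[x]` is additive: `f(x + y) = f(x) + f(y)` in `K[x, y]`. -/
def IsAdditivePoly {K : Type u} [Field K] (f : K[X]) : Prop :=
  aeval (MvPolynomial.X 0 + MvPolynomial.X 1 : MvPolynomial (Fin 2) K) f =
    aeval (MvPolynomial.X 0 : MvPolynomial (Fin 2) K) f +
      aeval (MvPolynomial.X 1 : MvPolynomial (Fin 2) K) f

/-- The set `𝒜_K` of additive polynomials with coefficients in `K`. -/
structure AdditivePoly (K : Type u) [Field K] where
  /-- the underlying polynomial -/
  poly : K[X]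
  isAdditive : IsAdditivePoly poly

namespace AdditivePoly

theorem aeval_add {K : Type u} [Field K] (R : AdditivePoly K) {A : Type v} [CommRing A]
    [Algebra K A] (x y : A) : aeval (x + y) R.poly = aeval x R.poly + aeval y R.poly := by
  have h := congrArg (MvPolynomial.aeval (![x, y] : Fin 2 → A)) R.isAdditive
  simpa [← Polynomial.aeval_algHom_apply] using h

theorem aeval_zero {K : Type u} [Field K] (R : AdditivePoly K) {A : Type v} [CommRing A]
    [Algebra K A] : aeval (0 : A) R.poly = 0 := by
  have h := R.aeval_add (0 : A) 0
  simpa using h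

/-- Extension of scalars `𝒜_k → 𝒜_K`. -/
noncomputable def baseChange {k : Type v} [Field k] (R : AdditivePoly k) (K : Type u) [Field K] [Algebra k K] :
    AdditivePoly K where
  poly := R.poly.map (algebraMap k K)
  isAdditive := by
    unfold IsAdditivePoly
    simp only [Polynomial.aeval_map_algebraMap]
    exact R.aeval_add _ _

theorem coeff_eq_zero {p : ℕ} [Fact p.Prime] {K : Type u} [Field K] [CharP K p]
    (R : AdditivePoly K) (j : ℕ) (hj : ∀ i, j ≠ p ^ i) : R.poly.coeff j = 0 := by
  rcases Nat.eq_zero_or_pos j with rfl | hj0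
  · have h := R.aeval_zero (A := K)
    rwa [Polynomial.coe_aeval_eq_eval, ← Polynomial.coeff_zero_eq_eval_zero] at h
  by_contra hne
  refine hj _ (Choose.eq_pow_multiplicity_of_choose_modEq_zero_nat (p := p) hj0 ?_)
  intro n hnI
  obtain ⟨hn1, hn2⟩ := Finset.mem_Icc.mp hnI
  have hn0 : n ≠ 0 := by omega
  have hn : n < j := by omega
  have hT : Polynomial.taylor (X : K[X]) (R.poly.map C) = R.poly.map C + C R.poly := by
    have h := R.aeval_add (A := K[X][X]) X (C X)
    have e1 : aeval (X + C X : K[X][X]) R.poly = Polynomial.taylor (X : K[X]) (R.poly.map C) := by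
      rw [Polynomial.taylor_apply, Polynomial.comp, Polynomial.eval₂_map, Polynomial.aeval_def]
      rfl
    have e2 : aeval (X : K[X][X]) R.poly = R.poly.map C := by
      rw [Polynomial.aeval_def, Polynomial.map]
      rfl
    have e3 : aeval (C X : K[X][X]) R.poly = C R.poly := by
      have := Polynomial.aeval_algHom_apply (CAlgHom (R := K) (A := K[X])) X R.poly
      simpa using this
    rw [← e1, h, e2, e3]
  have h2 := congrArg (fun g => (Polynomial.coeff g n).coeff (j - n)) hT
  simp only [Polynomial.taylor_coeff, Polynomial.coeff_add, Polynomial.coeff_C, hn0,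
    if_false, Polynomial.coeff_map, add_zero] at h2
  have h3 : (Polynomial.hasseDeriv n (R.poly.map C)).eval (X : K[X]) =
      Polynomial.hasseDeriv n R.poly := by
    have : Polynomial.hasseDeriv n (R.poly.map C) = (Polynomial.hasseDeriv n R.poly).map C := by
      ext i : 1
      simp [Polynomial.hasseDeriv_coeff]
    rw [this, Polynomial.eval_map, Polynomial.eval₂_C_X]
  rw [h3, Polynomial.hasseDeriv_coeff, if_neg (by omega), Nat.sub_add_cancel hn.le] at h2
  have h4 : ((j.choose n : ℕ) : K) = 0 := (mul_eq_zero.mp h2).resolve_right hne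
  exact (Nat.modEq_zero_iff_dvd).mpr ((CharP.cast_eq_zero_iff K p _).mp h4)

/-- The integer `e` with `deg R = p ^ e` (for `R ≠ 0`). -/
def e (p : ℕ) {K : Type u} [Field K] (R : AdditivePoly K) : ℕ := Nat.log p R.poly.natDegree

/-- The coefficient `a_i` of `x ^ (p ^ i)` in `R`. -/
def a (p : ℕ) {K : Type u} [Field K] (R : AdditivePoly K) (i : ℕ) : K := R.poly.coeff (p ^ i)

theorem aeval_eq_sum (p : ℕ) [Fact p.Prime] {K : Type u} [Field K] [CharP K p]
    (R : AdditivePoly K) {A : Type v} [CommRing A] [Algebra K A] (x : A) :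
    aeval x R.poly = ∑ i ∈ Finset.range (R.e p + 1), algebraMap K A (R.a p i) * x ^ p ^ i := by
  have hp := (Fact.out : p.Prime)
  rw [Polynomial.aeval_eq_sum_range]
  have hinj : Function.Injective (fun i : ℕ => p ^ i) := Nat.pow_right_injective hp.two_le
  have h1 : ∑ i ∈ Finset.range (R.e p + 1), algebraMap K A (R.a p i) * x ^ p ^ i =
      ∑ j ∈ (Finset.range (R.e p + 1)).image (fun i : ℕ => p ^ i), R.poly.coeff j • x ^ j := by
    rw [Finset.sum_image (fun _ _ _ _ h => hinj h)]
    exact Finset.sum_congr rfl fun i _ => (Algebra.smul_def _ _).symm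
  rw [h1]
  symm
  rcases eq_or_ne R.poly 0 with h0 | h0
  · simp [h0]
  by_cases hd : R.poly.natDegree = 0
  · exfalso
    apply h0
    rw [Polynomial.eq_C_of_natDegree_eq_zero hd, R.coeff_eq_zero (p := p) 0 (fun i => by
      exact (pow_pos hp.pos i).ne), C_0]
  refine Finset.sum_subset ?_ ?_
  · intro j hj
    obtain ⟨i, hi, rfl⟩ := Finset.mem_image.mp hj
    rw [Finset.mem_range, Nat.lt_succ_iff] at hi ⊢
    exact (Nat.le_log_iff_pow_le hp.one_lt hd).mp hi
  · intro j hj hj'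
    rw [R.coeff_eq_zero (p := p) j, zero_smul]
    rintro i rfl
    apply hj'
    refine Finset.mem_image_of_mem _ ?_
    rw [Finset.mem_range, Nat.lt_succ_iff] at hj ⊢
    exact (Nat.le_log_iff_pow_le hp.one_lt hd).mpr hj

/-- `E_R(x) = R(x)^{p^e} + ∑_{i ≤ e} (a_i x)^{p^{e-i}}`. -/
noncomputable def E (p : ℕ) {K : Type u} [Field K] (R : AdditivePoly K) : K[X] :=
  R.poly ^ p ^ R.e p + ∑ i ∈ Finset.range (R.e p + 1), (C (R.a p i) * X) ^ p ^ (R.e p - i)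

/-- `d_R = gcd {p^i + 1 | a_i ≠ 0}`. -/
noncomputable def d (p : ℕ) {K : Type u} [Field K] (R : AdditivePoly K) : ℕ :=
  open Classical in
  ((Finset.range (R.e p + 1)).filter fun i => R.a p i ≠ 0).gcd fun i => p ^ i + 1

/-- `d_{R,m} = d_R / gcd(d_R, m)`. -/
noncomputable def dm (p : ℕ) {K : Type u} [Field K] (R : AdditivePoly K) (m : ℕ) : ℕ :=
  R.d p / Nat.gcd (R.d p) m

/-- The polynomial `f_R(x, y)`, evaluated at elements `x, y` of a `K`-algebra:
`f_R(x,y) = -∑_{i<e} (∑_{j<e-i} (a_i x^{p^i} y)^{p^j} + (x R(y))^{p^i})`. -/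
noncomputable def f (p : ℕ) {K : Type u} [Field K] (R : AdditivePoly K) {A : Type v} [CommRing A]
    [Algebra K A] (x y : A) : A :=
  -∑ i ∈ Finset.range (R.e p),
    (∑ j ∈ Finset.range (R.e p - i), (algebraMap K A (R.a p i) * x ^ p ^ i * y) ^ p ^ j +
      (x * aeval y R.poly) ^ p ^ i)

section

variable (p : ℕ) [Fact p.Prime] {K : Type u} [Field K] [CharP K p] (R : AdditivePoly K)
  {A : Type v} [CommRing A] [Algebra K A] [CharP A p]

theorem aeval_E_add (x y : A) :
    aeval (x + y) (R.E p) = aeval x (R.E p) + aeval y (R.E p) := by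
  simp only [E, map_add, map_pow, map_sum, map_mul, aeval_X, aeval_C, R.aeval_add,
    add_pow_char_pow, mul_add, Finset.sum_add_distrib]
  ring

theorem f_add_left (x x' y : A) : R.f p (x + x') y = R.f p x y + R.f p x' y := by
  simp only [f, add_pow_char_pow, mul_add, add_mul, Finset.sum_add_distrib]
  ring

theorem f_add_right (x y y' : A) : R.f p x (y + y') = R.f p x y + R.f p x y' := by
  simp only [f, R.aeval_add, add_pow_char_pow, mul_add, Finset.sum_add_distrib]
  ring

theorem f_pow_sub (x y : A) :
    R.f p x y ^ p - R.f p x y =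
      -x ^ p ^ R.e p * aeval y (R.E p) + x * aeval y R.poly + y * aeval x R.poly := by
  have tele : ∀ (z : A) (n : ℕ), (∑ j ∈ Finset.range n, z ^ p ^ j) ^ p -
      ∑ j ∈ Finset.range n, z ^ p ^ j = z ^ p ^ n - z := by
    intro z n
    rw [sum_pow_char p]
    simp only [← pow_mul, ← pow_succ]
    rw [← Finset.sum_sub_distrib, Finset.sum_range_sub (fun j => z ^ p ^ j)]
    simp
  have hneg : ∀ z : A, (-z) ^ p = -z ^ p := fun z => map_neg (frobenius A p) z
  have h1 : R.f p x y ^ p - R.f p x y =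
      -∑ i ∈ Finset.range (R.e p),
        ((algebraMap K A (R.a p i) * x ^ p ^ i * y) ^ p ^ (R.e p - i) -
          algebraMap K A (R.a p i) * x ^ p ^ i * y) -
      ((x * aeval y R.poly) ^ p ^ R.e p - x * aeval y R.poly) := by
    rw [← tele (x * aeval y R.poly) (R.e p), Finset.sum_congr rfl fun i _ => (tele _ _).symm]
    simp only [f, hneg, Finset.sum_add_distrib, add_pow_char, Finset.sum_sub_distrib]
    rw [sum_pow_char p]
    ring
  have h2 : x ^ p ^ R.e p * aeval y (R.E p) = (x * aeval y R.poly) ^ p ^ R.e p +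
      ∑ i ∈ Finset.range (R.e p),
        (algebraMap K A (R.a p i) * x ^ p ^ i * y) ^ p ^ (R.e p - i) +
      algebraMap K A (R.a p (R.e p)) * x ^ p ^ R.e p * y := by
    simp only [E, map_add, map_pow, map_sum, map_mul, aeval_X, aeval_C, mul_add]
    rw [Finset.sum_range_succ, mul_add, Finset.mul_sum, ← add_assoc]
    refine congrArg₂ (· + ·) (congrArg₂ (· + ·) ?_ ?_) ?_
    · rw [mul_pow]
    · refine Finset.sum_congr rfl fun i hi => ?_
      have : p ^ R.e p = p ^ i * p ^ (R.e p - i) := by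
        rw [← pow_add, Nat.add_sub_cancel' (Finset.mem_range.mp hi).le]
      nth_rewrite 1 [this]
      simp only [mul_pow, pow_mul]
      ring
    · simp
      ring
  have h3 : y * aeval x R.poly =
      ∑ i ∈ Finset.range (R.e p), algebraMap K A (R.a p i) * x ^ p ^ i * y +
      algebraMap K A (R.a p (R.e p)) * x ^ p ^ R.e p * y := by
    rw [R.aeval_eq_sum p x, Finset.sum_range_succ, mul_add, Finset.mul_sum]
    congr 1
    · exact Finset.sum_congr rfl fun i _ => by ring
    · ring
  rw [h1, neg_mul, h2, h3, Finset.sum_sub_distrib]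
  ring

end

/-! ### The symplectic module `V_R` -/

section

variable (p : ℕ) [Fact p.Prime] {K : Type u} [Field K] [CharP K p] (R : AdditivePoly K)

/-- `V_R = {β ∈ K | E_R(β) = 0}` (for `K` algebraically closed), an `𝔽_p`-vector space. -/
noncomputable def V [Algebra (ZMod p) K] : Submodule (ZMod p) K :=
  AddSubgroup.toZModSubmodule p
    { carrier := {β | aeval β (R.E p) = 0}
      add_mem' := fun {x y} hx hy => by
        simp only [Set.mem_ofPred_eq] at hx hy ⊢
        rw [R.aeval_E_add p, hx, hy, add_zero]
      zero_mem' := by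
        have h := R.aeval_E_add p (0 : K) 0
        simpa using h
      neg_mem' := fun {x} hx => by
        simp only [Set.mem_ofPred_eq] at hx ⊢
        have h0 := R.aeval_E_add p (0 : K) 0
        have h := R.aeval_E_add p x (-x)
        rw [add_neg_cancel, hx, zero_add] at h
        rw [← h]
        simpa using h0 }

/-- The symplectic form `ω_R(β, β') = f_R(β, β') - f_R(β', β)` on `V_R`
(its values on `V_R` lie in `𝔽_p ⊆ K`). -/
noncomputable def omega (x y : K) : K := R.f p x y - R.f p y x

/-- `U` is an `𝔽_p[ℋ]`-submodule of `V_R`. Here `ℋ = μ_d ⋊ (ℤ/r)`, `d = d_{R,m}`, is generated by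
`τ` and `σ`, where `τ` is a generator of `μ_d` and acts on `V_R` by multiplication, and `σ` acts by
`x ↦ x ^ q`. -/
structure IsHSubmodule [Algebra (ZMod p) K] (q m : ℕ) (U : Submodule (ZMod p) K) : Prop where
  le_V : U ≤ R.V p
  mul_mem : ∀ α : K, α ^ R.dm p m = 1 → ∀ x ∈ U, α * x ∈ U
  frob_mem : ∀ x ∈ U, x ^ q ∈ U

/-- `U` is totally isotropic for `ω_R`. -/
def IsTotallyIsotropic [Algebra (ZMod p) K] (U : Submodule (ZMod p) K) : Prop :=
  ∀ x ∈ U, ∀ y ∈ U, R.omega p x y = 0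

/-- `(V_R, ω_R)` is completely anisotropic: it has no non-zero totally isotropic
`𝔽_p[ℋ]`-submodule. -/
def IsCompletelyAnisotropic [Algebra (ZMod p) K] (q m : ℕ) : Prop :=
  ¬ ∃ U : Submodule (ZMod p) K, R.IsHSubmodule p q m U ∧ U ≠ ⊥ ∧ R.IsTotallyIsotropic p U

/-! ### The group `H_R` -/

/-- The group `H_R` of the triples `(1, β, γ)` with `β ∈ V_R` and `γ ^ p - γ = β R(β)`. -/
@[ext]
structure H where
  /-- the second component -/
  β : K
  /-- the third component -/
  γ : K
  E_eq_zero : aeval β (R.E p) = 0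
  pow_sub : γ ^ p - γ = β * aeval β R.poly

namespace H

variable {p R}

/-- `(1, β₁, γ₁) (1, β₂, γ₂) = (1, β₁ + β₂, γ₁ + γ₂ + f_R(β₁, β₂))`. -/
noncomputable instance : Mul (H p R) where
  mul g h :=
    { β := g.β + h.β
      γ := g.γ + h.γ + R.f p g.β h.β
      E_eq_zero := by rw [R.aeval_E_add p, g.E_eq_zero, h.E_eq_zero, add_zero]
      pow_sub := by
        have h1 := R.f_pow_sub p g.β h.β
        rw [h.E_eq_zero] at h1
        rw [add_pow_char, add_pow_char, R.aeval_add]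
        linear_combination g.pow_sub + h.pow_sub + h1 }

noncomputable instance : One (H p R) where
  one :=
    { β := 0
      γ := 0
      E_eq_zero := by
        have h := R.aeval_E_add p (0 : K) 0
        simpa using h
      pow_sub := by simp [(Fact.out : p.Prime).ne_zero] }

theorem f_zero_left (x : K) : R.f p 0 x = 0 := by
  have h := R.f_add_left p (0 : K) 0 x
  simpa using h

theorem f_zero_right (x : K) : R.f p x 0 = 0 := by
  have h := R.f_add_right p x (0 : K) 0
  simpa using h

theorem f_neg_left (x y : K) : R.f p (-x) y = -R.f p x y := by
  have h := R.f_add_left p x (-x) y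
  rw [add_neg_cancel, f_zero_left] at h
  linear_combination -h

theorem neg_pow' (x : K) : (-x) ^ p = -x ^ p :=
  map_neg (frobenius K p) x

noncomputable instance : Inv (H p R) where
  inv g :=
    { β := -g.β
      γ := -g.γ + R.f p g.β g.β
      E_eq_zero := by
        have h := R.aeval_E_add p g.β (-g.β)
        have h0 := R.aeval_E_add p (0 : K) 0
        rw [add_neg_cancel, g.E_eq_zero, zero_add] at h
        rw [← h]
        simpa using h0
      pow_sub := by
        have h1 := R.f_pow_sub p g.β g.β
        rw [g.E_eq_zero] at h1
        have h2 := R.aeval_add g.β (-g.β)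
        rw [add_neg_cancel, R.aeval_zero] at h2
        rw [add_pow_char, neg_pow']
        linear_combination -g.pow_sub + h1 - g.β * h2 }

noncomputable instance : Group (H p R) :=
  Group.ofLeftAxioms
    (fun g h k => by
      apply H.ext
      · exact add_assoc _ _ _
      · change g.γ + h.γ + R.f p g.β h.β + k.γ + R.f p (g.β + h.β) k.β =
          g.γ + (h.γ + k.γ + R.f p h.β k.β) + R.f p g.β (h.β + k.β)
        rw [R.f_add_left p, R.f_add_right p]
        ring)
    (fun g => by
      apply H.ext
      · exact zero_add _
      · change 0 + g.γ + R.f p 0 g.β = g.γ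
        rw [f_zero_left]
        ring)
    (fun g => by
      apply H.ext
      · exact neg_add_cancel _
      · change -g.γ + R.f p g.β g.β + g.γ + R.f p (-g.β) g.β = 0
        rw [f_neg_left]
        ring)

/-- For `g = (1, β, γ)`: the set `{(1, ξ β, ξ² γ) | ξ ∈ 𝔽_p} ⊆ H_R`. -/
def line [Algebra (ZMod p) K] (g : H p R) : Set (H p R) :=
  {h | ∃ ξ : ZMod p, h.β = ξ • g.β ∧ h.γ = ξ ^ 2 • g.γ}

end H

/-! ### The affine curve `C_R` and quotients of it -/

/-- The coordinate ring `K[x][a] / (a ^ p - a - x R(x))` of `C_R`. -/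
abbrev CoordRing (p : ℕ) {K : Type u} [Field K] (R : AdditivePoly K) : Type u :=
  AdjoinRoot (X ^ p - X - C (X * R.poly) : K[X][X])

/-- The coordinate function `x` on `C_R`. -/
noncomputable def xC (p : ℕ) {K : Type u} [Field K] (R : AdditivePoly K) : CoordRing p R :=
  AdjoinRoot.of _ X

/-- The coordinate function `a` on `C_R`. -/
noncomputable def aC (p : ℕ) {K : Type u} [Field K] (R : AdditivePoly K) : CoordRing p R :=
  AdjoinRoot.root _

theorem aeval_xC (g : K[X]) : aeval (R.xC p) g =
    AdjoinRoot.of (X ^ p - X - C (X * R.poly) : K[X][X]) g := by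
  have h : aeval (R.xC p) g = ((AdjoinRoot.ofAlgHom K
      (X ^ p - X - C (X * R.poly) : K[X][X])).comp (AlgHom.id K K[X])) g := by
    congr 1
    ext
    simp [xC]
  rw [h]
  rfl

theorem aC_pow_sub : R.aC p ^ p - R.aC p = R.xC p * aeval (R.xC p) R.poly := by
  have h := AdjoinRoot.eval₂_root (X ^ p - X - C (X * R.poly) : K[X][X])
  simp only [eval₂_sub, eval₂_pow, eval₂_X, eval₂_C] at h
  rw [aeval_xC, xC, ← map_mul]
  exact sub_eq_zero.mp h

/-- The `K`-algebra homomorphism from the coordinate ring of `C_R` to `A` given by the point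
`(a, x) = (s, t)`. -/
noncomputable def pointHom {A : Type v} [CommRing A] [Algebra K A] (s t : A)
    (h : s ^ p - s = t * aeval t R.poly) : CoordRing p R →ₐ[K] A :=
  AdjoinRoot.liftAlgHom _ (aeval t) s (by
    simp only [eval₂_sub, eval₂_pow, eval₂_X, eval₂_C, RingHom.coe_coe]
    rw [map_mul, aeval_X]
    exact sub_eq_zero.mpr h)

theorem pow_sub_of_zero {A : Type v} [CommRing A] [Algebra K A] (x y : A)
    (hy : aeval y (R.E p) = 0) (s c : A) (hs : s ^ p - s = x * aeval x R.poly)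
    (hc : c ^ p - c = y * aeval y R.poly) :
    (s + R.f p x y + c) ^ p - (s + R.f p x y + c) = (x + y) * aeval (x + y) R.poly := by
  rcases subsingleton_or_nontrivial A with hA | hA
  · exact Subsingleton.elim _ _
  have : CharP A p := charP_of_injective_algebraMap (algebraMap K A).injective p
  have h1 := R.f_pow_sub p x y
  rw [hy] at h1
  rw [add_pow_char, add_pow_char, R.aeval_add]
  linear_combination hs + hc + h1

/-- The pull-back of functions along the automorphism
`(a, x) ↦ (a, x) · (1, β, γ) = (a + f_R(x, β) + γ, x + β)` of `C_R`. -/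
noncomputable def actHom (g : H p R) : CoordRing p R →ₐ[K] CoordRing p R :=
  R.pointHom p
    (R.aC p + R.f p (R.xC p) (algebraMap K _ g.β) + algebraMap K _ g.γ)
    (R.xC p + algebraMap K _ g.β)
    (R.pow_sub_of_zero p _ _
      (by rw [Polynomial.aeval_algebraMap_apply, g.E_eq_zero, map_zero]) _ _
      (R.aC_pow_sub p)
      (by rw [Polynomial.aeval_algebraMap_apply, ← map_pow, ← map_sub, g.pow_sub, map_mul]))

/-- The ring of functions on `C_R` that are invariant under the subgroup `G ⊆ H_R`. -/
noncomputable def invariants (G : Subgroup (H p R)) : Subalgebra K (CoordRing p R) :=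
  ⨅ g ∈ G, AlgHom.equalizer (R.actHom p g) (AlgHom.id K _)

open AlgebraicGeometry CategoryTheory

/-- The affine curve `C_R : a ^ p - a = x R(x)`. -/
noncomputable def curve (p : ℕ) {K : Type u} [Field K] (R : AdditivePoly K) : Scheme.{u} :=
  Spec (CommRingCat.of (CoordRing p R))

/-- The structure morphism of `C_R`. -/
noncomputable def curveStr (p : ℕ) {K : Type u} [Field K] (R : AdditivePoly K) :
    R.curve p ⟶ Spec (CommRingCat.of K) :=
  Spec.map (CommRingCat.ofHom (algebraMap K (CoordRing p R)))

/-- The quotient `C_R / G` of the affine curve `C_R` by the finite group `G ⊆ H_R`: the spectrum of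
the ring of invariants. -/
noncomputable def quotient (G : Subgroup (H p R)) : Scheme.{u} :=
  Spec (CommRingCat.of (R.invariants p G))

/-- The structure morphism of `C_R / G`. -/
noncomputable def quotientStr (G : Subgroup (H p R)) :
    R.quotient p G ⟶ Spec (CommRingCat.of K) :=
  Spec.map (CommRingCat.ofHom (algebraMap K (R.invariants p G)))

/-- The quotient morphism `C_R → C_R / G`. -/
noncomputable def quotientMap (G : Subgroup (H p R)) : R.curve p ⟶ R.quotient p G :=
  Spec.map (CommRingCat.ofHom (R.invariants p G).val.toRingHom)

/-- The morphism `π : C_R → C_{R₁}, (a, x) ↦ (a - Δ(x), r(x))`, defined when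
`x R(x) = r(x) R₁(r(x)) + Δ(x)^p - Δ(x)`. -/
noncomputable def piMap (R₁ r : AdditivePoly K) (Δ : K[X])
    (h : X * R.poly = r.poly * R₁.poly.comp r.poly + Δ ^ p - Δ) :
    R.curve p ⟶ R₁.curve p :=
  Spec.map (CommRingCat.ofHom (R₁.pointHom p
    (R.aC p - aeval (R.xC p) Δ) (aeval (R.xC p) r.poly) (by
      rcases subsingleton_or_nontrivial (CoordRing p R) with hA | hA
      · exact Subsingleton.elim _ _
      have : CharP (CoordRing p R) p :=
        charP_of_injective_algebraMap (algebraMap K (CoordRing p R)).injective p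
      have h1 := congrArg (aeval (R.xC p)) h
      simp only [map_mul, map_sub, map_add, map_pow, aeval_X, Polynomial.aeval_comp] at h1
      rw [sub_pow_char]
      linear_combination R.aC_pow_sub p + h1)).toRingHom)

end

end AdditivePoly

/-!
The proof is explicit. Write `r` for the product of the `x - u`, `u ∈ U`. It is additive, since
`r(x + y) - r(x) - r(y)` has degree less than `#U` in `x` and vanishes on `U`
(`vanishingAdditivePoly`). It is separable, so its coefficient of `x` is non-zero; this turns the
evident `r(αx) = α ^ #U r(x)` into `r(αx) = α r(x)`, and stability under `x ↦ x ^ q` puts the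
coefficients of `r` into `𝔽_q`.

As `U` is totally isotropic, `f_R` is symmetric on `U`, so that `β ↦ (1, β, f_R(β, β) / 2)` is a
homomorphism `U → H_R` (`isotropicSection`), whose image is the product of the lines spanned by the
members of a basis.

The restriction of `f_R(x, y)` to `y ∈ U` extends to a symmetric biadditive polynomial map `B`,
because linear functionals on `U` are given by additive polynomials. For `Δ(x) = B(x, x) / 2` one
has `Δ(x + β) = Δ(x) + f_R(x, β) + f_R(β, β) / 2` for `β ∈ U`, which says that `a - Δ(x)` is
invariant under the image of `U` in `H_R`. Hence `x R(x) - Δ ^ p + Δ` is invariant under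
translations by `U`, so it is `M(r(x))` for some `M`. As `r` is additive and surjective, `M` is
again a quadratic form, that is, a combination of monomials `t ^ (p ^ a + p ^ b)`, and modulo
polynomials `D ^ p - D` any such `M` is of the form `t R₁(t)`. Replacing `Δ` by `Δ + D(r)` absorbs
this `D` and preserves the invariance of `a - Δ(x)` (`exists_descent`).

A polynomial of degree less than `p ^ (N + 1)` in which `x ^ (p ^ N + 1)` occurs, `N ≥ 1`, is not of
the form `D ^ p - D`. Comparing the monomials of this kind in `x R(x)` and `r(x) R₁(r(x))` gives
`e = dim U + e'` for `deg R₁ = p ^ e'`. The same argument shows that `r(x) Q(r(x))` is not of the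
form `D ^ p - D` for an additive `Q ≠ 0`; for `Q(t) = α R₁(αt) - R₁(t)` with `α` a primitive root of
unity of order `d_{R,m}` this gives `d_{R,m} ∣ d_{R₁}`.

Finally the powers `(a - Δ(x)) ^ i`, `i < p`, form a basis of the coordinate ring of `C_R` over
`F[x]`, and the image of `U` acts on the coefficients by translations of `x`. So the invariants are
the combinations with coefficients in `F[r(x)]`, which is the image of the coordinate ring of
`C_{R₁}` under the injective map `π^*` (`pointHom_range`, `pointHom_injective`).
-/

/-! ### Additive polynomials with prescribed zeros -/

/-- Over an infinite field, additivity may be tested on values. -/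
theorem isAdditivePoly_of_eval_add {K : Type u} [Field K] [Infinite K] {P : K[X]}
    (h : ∀ x y, P.eval (x + y) = P.eval x + P.eval y) : IsAdditivePoly P := by
  refine MvPolynomial.funext fun v => ?_
  have key : ∀ z : MvPolynomial (Fin 2) K,
      MvPolynomial.eval v (aeval z P) = P.eval (MvPolynomial.eval v z) := by
    intro z
    have h1 : (MvPolynomial.eval v).comp MvPolynomial.C = RingHom.id K := by ext; simp
    rw [aeval_def, hom_eval₂, MvPolynomial.algebraMap_eq, h1]
    exact eval₂_id
  rw [map_add, key, key, key, map_add, h]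

theorem AdditivePoly.eval_add {K : Type u} [Field K] (R : AdditivePoly K) (x y : K) :
    R.poly.eval (x + y) = R.poly.eval x + R.poly.eval y := by
  simpa using R.aeval_add x y

theorem AdditivePoly.eval_zero {K : Type u} [Field K] (R : AdditivePoly K) :
    R.poly.eval 0 = 0 := by
  simpa using R.aeval_zero (A := K)

/-- Evaluation of an additive polynomial, as a homomorphism of additive groups. -/
noncomputable def AdditivePoly.evalHom {K : Type u} [Field K] (R : AdditivePoly K) : K →+ K :=
  AddMonoidHom.mk' (fun x => R.poly.eval x) R.eval_add

@[simp]
theorem AdditivePoly.evalHom_apply {K : Type u} [Field K] (R : AdditivePoly K) (x : K) :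
    R.evalHom x = R.poly.eval x := rfl

section Vanishing

variable {p : ℕ} [Fact p.Prime] {F : Type u} [Field F] [Algebra (ZMod p) F]

/-- The monic polynomial whose zeros, all of them simple, are the elements of the finite
subspace `W`. -/
noncomputable def vanishingPoly (W : Submodule (ZMod p) F) [Fintype W] : F[X] :=
  ∏ w : W, (X - C (w : F))

variable (W : Submodule (ZMod p) F) [Fintype W]

theorem vanishingPoly_monic : (vanishingPoly W).Monic :=
  monic_prod_of_monic _ _ fun _ _ => monic_X_sub_C _

theorem vanishingPoly_natDegree : (vanishingPoly W).natDegree = Fintype.card W := by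
  simp [vanishingPoly, natDegree_prod_of_monic, monic_X_sub_C]

theorem vanishingPoly_eval_eq_zero_iff (x : F) : (vanishingPoly W).eval x = 0 ↔ x ∈ W := by
  simp only [vanishingPoly, eval_prod, eval_sub, eval_X, eval_C, Finset.prod_eq_zero_iff,
    Finset.mem_univ, true_and, sub_eq_zero]
  exact ⟨fun ⟨w, hw⟩ => hw ▸ w.2, fun h => ⟨⟨x, h⟩, rfl⟩⟩

theorem vanishingPoly_separable : (vanishingPoly W).Separable :=
  separable_prod_X_sub_C_iff.mpr Subtype.val_injective

theorem vanishingPoly_eval_add_of_mem {w : F} (hw : w ∈ W) (x : F) :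
    (vanishingPoly W).eval (x + w) = (vanishingPoly W).eval x := by
  simp only [vanishingPoly, eval_prod, eval_sub, eval_X, eval_C]
  refine Fintype.prod_equiv (Equiv.subRight (⟨w, hw⟩ : W)) _ _ fun v => ?_
  simp
  ring

/-- A polynomial of degree less than `#W` that vanishes on `W` is zero. -/
theorem eq_zero_of_eval_eq_zero_of_mem {G : F[X]} (hd : G.natDegree < Fintype.card W)
    (h : ∀ w ∈ W, G.eval w = 0) : G = 0 := by
  classical
  refine eq_zero_of_natDegree_lt_card_of_eval_eq_zero' G
    ((Finset.univ : Finset W).image Subtype.val) ?_ ?_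
  · intro x hx
    obtain ⟨w, -, rfl⟩ := Finset.mem_image.mp hx
    exact h _ w.2
  · rwa [Finset.card_image_of_injective _ Subtype.val_injective, Finset.card_univ]

theorem vanishingPoly_eval_add (x y : F) :
    (vanishingPoly W).eval (x + y) = (vanishingPoly W).eval x + (vanishingPoly W).eval y := by
  set r := vanishingPoly W with hr
  have hcard : 0 < Fintype.card W := Fintype.card_pos
  have hdeg : r.natDegree = Fintype.card W := vanishingPoly_natDegree W
  have hmon : r.Monic := vanishingPoly_monic W
  -- As a polynomial in `x`, the difference of the two sides has lower degree than `r`.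
  have hG : taylor y r - r - C (r.eval y) = 0 := by
    refine eq_zero_of_eval_eq_zero_of_mem W ?_ fun w hw => ?_
    · refine lt_of_le_of_lt (natDegree_sub_C).le ?_
      rw [← hdeg]
      by_cases h0 : taylor y r - r = 0
      · rw [h0, natDegree_zero, hdeg]; exact hcard
      refine natDegree_lt_natDegree h0 ?_
      have htm : (taylor y r).Monic := by
        rw [Monic, leadingCoeff_taylor]; exact hmon
      have := degree_sub_lt_left (p := taylor y r) (q := r) (degree_taylor r y)
        htm.ne_zero (by rw [htm.leadingCoeff, hmon.leadingCoeff])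
      rwa [degree_taylor] at this
    · have h1 : r.eval w = 0 := (vanishingPoly_eval_eq_zero_iff W w).mpr hw
      have h2 : r.eval (w + y) = r.eval y := by
        rw [add_comm]; exact vanishingPoly_eval_add_of_mem W hw y
      simp [taylor_eval, h1, h2]
  have := congrArg (Polynomial.eval x) hG
  simp only [eval_sub, taylor_eval, eval_C, Polynomial.eval_zero] at this
  linear_combination this

/-- The vanishing polynomial of `W` is additive: `r(x + y) - r(x) - r(y)`, as a polynomial in `x`,
vanishes on `W` and has degree less than `#W`. -/
noncomputable def vanishingAdditivePoly [Infinite F] : AdditivePoly F where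
  poly := vanishingPoly W
  isAdditive := isAdditivePoly_of_eval_add (vanishingPoly_eval_add W)

/-- Linear functionals on a finite-dimensional subspace are given by additive polynomials: for a
linearly independent family there is a dual family of additive polynomials. -/
theorem exists_dual_additivePoly [Infinite F] {ι : Type*} [Finite ι] [DecidableEq ι] {b : ι → F}
    (hb : LinearIndependent (ZMod p) b) :
    ∃ l : ι → AdditivePoly F, ∀ i j, (l i).poly.eval (b j) = if i = j then 1 else 0 := by
  have key : ∀ i, ∃ l : AdditivePoly F, ∀ j, l.poly.eval (b j) = if i = j then 1 else 0 := by
    intro i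
    let W : Submodule (ZMod p) F := Submodule.span (ZMod p) (b '' {i}ᶜ)
    have : Module.Finite (ZMod p) W := Module.Finite.span_of_finite _ (Set.toFinite _)
    have : Finite W := Module.finite_of_finite (ZMod p)
    have := Fintype.ofFinite W
    have hi : (vanishingPoly W).eval (b i) ≠ 0 := by
      rw [Ne, vanishingPoly_eval_eq_zero_iff]
      exact hb.notMem_span_image (by simp)
    refine ⟨⟨C ((vanishingPoly W).eval (b i))⁻¹ * vanishingPoly W,
      isAdditivePoly_of_eval_add fun x y => ?_⟩, fun j => ?_⟩
    · simp only [eval_mul, eval_C, vanishingPoly_eval_add, mul_add]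
    · simp only [eval_mul, eval_C]
      split_ifs with h
      · rw [← h, inv_mul_cancel₀ hi]
      · rw [(vanishingPoly_eval_eq_zero_iff W (b j)).mpr, mul_zero]
        exact Submodule.subset_span ⟨j, fun h' => h h'.symm, rfl⟩
  choose l hl using key
  exact ⟨l, hl⟩

/-- A polynomial that is invariant under the translations by `W` is a polynomial in the vanishing
polynomial of `W`. -/
theorem exists_eq_comp_vanishingPoly [Infinite F] (P : F[X])
    (hP : ∀ w ∈ W, ∀ x, P.eval (x + w) = P.eval x) : ∃ M : F[X], P = M.comp (vanishingPoly W) := by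
  induction hn : P.natDegree using Nat.strong_induction_on generalizing P with
  | _ n ih =>
  have hmon := vanishingPoly_monic W
  have hcard : 0 < Fintype.card W := Fintype.card_pos
  have hdvd : vanishingPoly W ∣ P - C (P.eval 0) := by
    refine Finset.prod_dvd_of_coprime (fun v _ w _ hvw => ?_) fun w _ => ?_
    · exact pairwise_coprime_X_sub_C Subtype.val_injective hvw
    · rw [dvd_iff_isRoot]
      have := hP w w.2 0
      rw [zero_add] at this
      simp [this]
  obtain ⟨Q, hQ⟩ := hdvd
  have hPQ : P = C (P.eval 0) + vanishingPoly W * Q := by rw [← hQ]; ring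
  by_cases hQ0 : Q = 0
  · exact ⟨C (P.eval 0), by rw [C_comp]; simpa [hQ0] using hPQ⟩
  have hQinv : ∀ w ∈ W, ∀ x, Q.eval (x + w) = Q.eval x := by
    intro w hw x
    have h1 : vanishingPoly W * (taylor w Q - Q) = 0 := by
      refine Polynomial.funext fun y => ?_
      have e1 := congrArg (Polynomial.eval y) hPQ
      have e2 := congrArg (Polynomial.eval (y + w)) hPQ
      simp only [Polynomial.eval_add, eval_mul, eval_C] at e1 e2
      rw [vanishingPoly_eval_add_of_mem W hw, hP w hw] at e2
      simp only [eval_mul, eval_sub, taylor_eval, Polynomial.eval_zero]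
      linear_combination e1 - e2
    have h2 := congrArg (Polynomial.eval x) ((mul_eq_zero.mp h1).resolve_left hmon.ne_zero)
    simp only [eval_sub, taylor_eval, Polynomial.eval_zero] at h2
    exact sub_eq_zero.mp h2
  have hlt : Q.natDegree < n := by
    have : (P - C (P.eval 0)).natDegree = Fintype.card W + Q.natDegree := by
      rw [hQ, hmon.natDegree_mul' hQ0, vanishingPoly_natDegree]
    rw [natDegree_sub_C, hn] at this
    omega
  obtain ⟨M, hM⟩ := ih _ hlt Q hQinv rfl
  refine ⟨C (P.eval 0) + X * M, ?_⟩
  rw [add_comp, C_comp, mul_comp, X_comp, ← hM]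
  exact hPQ

end Vanishing

/-! ### Quadratic polynomials -/

/-- The polynomial function of `N` is a quadratic form for the additive group of `F`: up to the
factor `2` it is the diagonal of a biadditive map, which is not required to be symmetric. -/
def IsQuadraticPoly {F : Type u} [Field F] (N : F[X]) : Prop :=
  ∃ B : F →+ F →+ F, ∀ x, 2 * N.eval x = B x x

namespace IsQuadraticPoly

variable {F : Type u} [Field F]

theorem add {N N' : F[X]} (h : IsQuadraticPoly N) (h' : IsQuadraticPoly N') :
    IsQuadraticPoly (N + N') := by
  obtain ⟨B, hB⟩ := h
  obtain ⟨B', hB'⟩ := h'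
  exact ⟨B + B', fun x => by simp [mul_add, hB, hB']⟩

theorem sub {N N' : F[X]} (h : IsQuadraticPoly N) (h' : IsQuadraticPoly N') :
    IsQuadraticPoly (N - N') := by
  obtain ⟨B, hB⟩ := h
  obtain ⟨B', hB'⟩ := h'
  exact ⟨B - B', fun x => by simp [mul_sub, hB, hB']⟩

theorem pow_char {p : ℕ} [Fact p.Prime] [CharP F p] {N : F[X]} (h : IsQuadraticPoly N) :
    IsQuadraticPoly (N ^ p) := by
  obtain ⟨B, hB⟩ := h
  let φ : F →+ F := (frobenius F p).toAddMonoidHom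
  refine ⟨(AddMonoidHom.compHom φ).comp B, fun x => ?_⟩
  have h2 : (2 : F) ^ p = 2 := map_ofNat (frobenius F p) 2
  change 2 * (N ^ p).eval x = (B x x) ^ p
  rw [← hB, mul_pow, h2, eval_pow]

theorem mul_of_additive (P Q : AdditivePoly F) : IsQuadraticPoly (P.poly * Q.poly) := by
  refine ⟨(AddMonoidHom.mul.comp ((AddMonoidHom.mulLeft 2).comp P.evalHom)).compl₂ Q.evalHom,
    fun x => ?_⟩
  simp [mul_assoc]

variable {N : F[X]} (h : IsQuadraticPoly N) (h2 : (2 : F) ≠ 0)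
include h h2

theorem eval_neg (x : F) : N.eval (-x) = N.eval x := by
  obtain ⟨B, hB⟩ := h
  apply mul_left_cancel₀ h2
  simp [hB]

/-- The polarisation of a quadratic polynomial is biadditive. -/
theorem polar_add (x y z : F) :
    N.eval (x + y + z) + N.eval x + N.eval y + N.eval z =
      N.eval (x + y) + N.eval (x + z) + N.eval (y + z) := by
  obtain ⟨B, hB⟩ := h
  apply mul_left_cancel₀ h2
  simp only [mul_add, hB, map_add, AddMonoidHom.add_apply]
  ring

end IsQuadraticPoly

theorem two_ne_zero_of_charP {p : ℕ} [Fact p.Prime] (hp2 : p ≠ 2) (F : Type u) [Field F]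
    [CharP F p] : (2 : F) ≠ 0 :=
  Ring.two_ne_zero (by rwa [ringChar.eq F p])

/-- A polynomial function `M` with biadditive polarisation and `M(-x) = M(x)` is a combination of
the monomials `x ^ (p ^ a + p ^ b)`. Indeed the coefficient of `s ^ k t ^ (j - k)` in `M(s + t)` is
`j.choose k` times a coefficient of `M`, and it vanishes unless `k` and `j - k` are powers of `p`;
some `j.choose k` with `0 < k < j` is prime to `p` unless `j` is a power of `p`, which is odd. -/
theorem exists_eq_pow_add_pow_of_coeff_ne_zero {p : ℕ} [hp : Fact p.Prime] (hp2 : p ≠ 2)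
    {F : Type u} [Field F] [CharP F p] [Infinite F] {M : F[X]}
    (heven : ∀ x, M.eval (-x) = M.eval x)
    (hpol : ∀ x y z, M.eval (x + y + z) + M.eval x + M.eval y + M.eval z =
      M.eval (x + y) + M.eval (x + z) + M.eval (y + z))
    {j : ℕ} (hj : M.coeff j ≠ 0) : ∃ a b, j = p ^ a + p ^ b := by
  have h2 := two_ne_zero_of_charP hp2 F
  have hM0 : M.eval 0 = 0 := by
    have := hpol 0 0 0
    simp only [add_zero] at this
    linear_combination this
  -- The coefficients of the polarisation.
  have key : ∀ k n : ℕ, 0 < k → 0 < n → M.coeff (n + k) ≠ 0 →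
      ¬ p ∣ (n + k).choose k → ∃ a, k = p ^ a := by
    intro k n hk hn hc hch
    by_contra hpow
    push Not at hpow
    have hconst : hasseDeriv k M = C (M.coeff k) := by
      refine Polynomial.funext fun t => ?_
      let P : AdditivePoly F := ⟨taylor t M - M - C (M.eval t),
        isAdditivePoly_of_eval_add fun x y => by
          simp only [eval_sub, taylor_eval, eval_C]
          linear_combination hpol x y t⟩
      have hP := P.coeff_eq_zero (p := p) k hpow
      simp only [P, coeff_sub, taylor_coeff, coeff_C, hk.ne', if_false, sub_zero] at hP
      rw [eval_C]
      exact sub_eq_zero.mp hP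
    have h3 := congrArg (fun q => q.coeff n) hconst
    simp only [hasseDeriv_coeff, coeff_C, hn.ne', if_false] at h3
    rcases mul_eq_zero.mp h3 with h4 | h4
    · exact hch ((CharP.cast_eq_zero_iff F p _).mp h4)
    · exact hc h4
  have hj0 : 0 < j := by
    rcases Nat.eq_zero_or_pos j with rfl | h
    · rw [coeff_zero_eq_eval_zero, hM0] at hj
      exact absurd rfl hj
    · exact h
  have hjeven : ¬ Odd j := by
    intro hodd
    have h3 : M.comp (C (-1) * X) = M := Polynomial.funext fun x => by simpa using heven x
    have h4 := congrArg (fun q => q.coeff j) h3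
    simp only [comp_C_mul_X_coeff, hodd.neg_one_pow] at h4
    have h5 : 2 * M.coeff j = 0 := by linear_combination -h4
    exact hj ((mul_eq_zero.mp h5).resolve_left h2)
  have hpodd : Odd p := hp.out.odd_of_ne_two hp2
  obtain ⟨k, hkI, hch⟩ : ∃ k ∈ Finset.Icc 1 (j - 1), ¬ j.choose k ≡ 0 [MOD p] := by
    by_contra hall
    push Not at hall
    apply hjeven
    rw [Choose.eq_pow_multiplicity_of_choose_modEq_zero_nat hj0 hall]
    exact hpodd.pow
  rw [Finset.mem_Icc] at hkI
  rw [Nat.modEq_zero_iff_dvd] at hch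
  obtain ⟨n, rfl⟩ : ∃ n, j = n + k := ⟨j - k, by omega⟩
  obtain ⟨a, ha⟩ := key k n (by omega) (by omega) hj hch
  obtain ⟨b, hb⟩ := key n k (by omega) (by omega) (by rwa [add_comm]) (by
    rwa [add_comm k n, Nat.choose_symm_add])
  exact ⟨b, a, by rw [← ha, ← hb]⟩

theorem isAdditivePoly_C_mul_X_pow {p : ℕ} [Fact p.Prime] {F : Type u} [Field F] [CharP F p]
    (c : F) (i : ℕ) : IsAdditivePoly (C c * X ^ p ^ i) := by
  simp only [IsAdditivePoly, map_mul, map_pow, aeval_X, aeval_C, add_pow_char_pow, mul_add]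

theorem IsAdditivePoly.add {F : Type u} [Field F] {P Q : F[X]} (hP : IsAdditivePoly P)
    (hQ : IsAdditivePoly Q) : IsAdditivePoly (P + Q) := by
  unfold IsAdditivePoly at *
  rw [map_add, map_add, map_add, hP, hQ]
  ring

/-- Modulo the polynomials `D ^ p - D`, over a perfect field every combination of the monomials
`t ^ (p ^ a + p ^ b)` is of the form `t Q(t)` with `Q` additive. -/
theorem exists_additivePoly_add_pow_sub {p : ℕ} [hp : Fact p.Prime] {F : Type u} [Field F]
    [CharP F p] [PerfectRing F p] {M : F[X]}
    (hM : ∀ j, M.coeff j ≠ 0 → ∃ a b, j = p ^ a + p ^ b) :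
    ∃ (Q : AdditivePoly F) (D : F[X]), D.eval 0 = 0 ∧ M = X * Q.poly + D ^ p - D := by
  have hp0 : p ≠ 0 := hp.out.ne_zero
  have hmon : ∀ (a i : ℕ) (c : F), ∃ (Q : AdditivePoly F) (D : F[X]), D.eval 0 = 0 ∧
      C c * X ^ (p ^ a * (1 + p ^ i)) = X * Q.poly + D ^ p - D := by
    intro a i
    induction a with
    | zero =>
      intro c
      refine ⟨⟨C c * X ^ p ^ i, isAdditivePoly_C_mul_X_pow c i⟩, 0, by simp, ?_⟩
      rw [zero_pow hp0]
      ring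
    | succ a ih =>
      intro c
      obtain ⟨c', rfl⟩ := (PerfectRing.bijective_frobenius (R := F) (p := p)).2 c
      obtain ⟨Q, D, hD0, hD⟩ := ih c'
      refine ⟨Q, D + C c' * X ^ (p ^ a * (1 + p ^ i)), ?_, ?_⟩
      · simp [hD0, hp0]
      · have : C (c' ^ p) * X ^ (p ^ (a + 1) * (1 + p ^ i)) =
            (C c' * X ^ (p ^ a * (1 + p ^ i)) : F[X]) ^ p := by
          rw [C_pow, mul_pow, ← pow_mul]
          ring
        simp only [this, add_pow_char]
        linear_combination hD
  rw [M.as_sum_support_C_mul_X_pow]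
  have hmem : ∀ j ∈ M.support, ∃ a b, j = p ^ a + p ^ b := fun j hj => hM j (mem_support_iff.mp hj)
  revert hmem
  induction M.support using Finset.induction_on with
  | empty =>
    exact fun _ => ⟨⟨0, by simp [IsAdditivePoly]⟩, 0, by simp, by simp [hp0]⟩
  | insert j s hjs ih =>
    intro hmem
    obtain ⟨Q, D, hD0, hD⟩ := ih fun i hi => hmem i (Finset.mem_insert_of_mem hi)
    obtain ⟨a, i, hai⟩ : ∃ a i, j = p ^ a * (1 + p ^ i) := by
      obtain ⟨a, b, hab⟩ := hmem j (Finset.mem_insert_self _ _)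
      rcases le_total a b with h | h
      · obtain ⟨i, rfl⟩ := Nat.exists_eq_add_of_le h
        exact ⟨a, i, by rw [hab, pow_add]; ring⟩
      · obtain ⟨i, rfl⟩ := Nat.exists_eq_add_of_le h
        exact ⟨b, i, by rw [hab, pow_add]; ring⟩
    obtain ⟨Q', D', hD0', hD'⟩ := hmon a i (M.coeff j)
    refine ⟨⟨Q'.poly + Q.poly, Q'.isAdditive.add Q.isAdditive⟩, D' + D, by simp [hD0, hD0'], ?_⟩
    rw [← hai] at hD'
    rw [Finset.sum_insert hjs, hD, hD', add_pow_char]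
    ring

/-! ### The descended polynomial `R₁` -/

namespace AdditivePoly

theorem map_f (p : ℕ) {K : Type u} [Field K] (R : AdditivePoly K) {A B : Type*} [CommRing A]
    [CommRing B] [Algebra K A] [Algebra K B] (φ : A →ₐ[K] B) (x y : A) :
    φ (R.f p x y) = R.f p (φ x) (φ y) := by
  simp only [f, map_neg, map_sum, map_add, map_pow, map_mul, AlgHom.commutes,
    Polynomial.aeval_algHom_apply]

variable {p : ℕ} [Fact p.Prime] {F : Type u} [Field F] [CharP F p]

/-- `f_R` as a biadditive map on the base field. -/
noncomputable def fHom (p : ℕ) [Fact p.Prime] [CharP F p] (R : AdditivePoly F) : F →+ F →+ F :=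
  AddMonoidHom.mk' (fun x => AddMonoidHom.mk' (fun y => R.f p x y) (R.f_add_right p x))
    fun x x' => by ext y; exact R.f_add_left p x x' y

theorem eval_f_X_C (R : AdditivePoly F) (x y : F) :
    (R.f p X (C y) : F[X]).eval x = R.f p x y := by
  have h := R.map_f p (aeval (R := F) x) X (C y)
  simpa using h

variable [Algebra (ZMod p) F] {U : Submodule (ZMod p) F}

theorem eq_on_of_eq_on_basis {ι : Type*} (b : Module.Basis ι (ZMod p) U) {g h : F →+ F}
    (hgh : ∀ i, g (b i) = h (b i)) {y : F} (hy : y ∈ U) : g y = h y := by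
  have : (g.comp U.subtype.toAddMonoidHom).toZModLinearMap p =
      (h.comp U.subtype.toAddMonoidHom).toZModLinearMap p := b.ext hgh
  exact LinearMap.congr_fun this ⟨y, hy⟩

/-- On a totally isotropic subspace `U`, where `f_R` is symmetric, the map `x, β ↦ f_R(x, β)` with
`β ∈ U` extends to a symmetric biadditive map `B` given by polynomials. The polynomial `Δ` is half
of its diagonal. In terms of a basis `b` of `U` and dual additive polynomials `l`, the map is
`B(x, y) = ∑ f(x, bᵢ) lᵢ(y) + ∑ f(y, bᵢ) lᵢ(x) - ∑ f(bᵢ, bⱼ) lᵢ(x) lⱼ(y)`. -/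
theorem exists_symmetric_extension [Infinite F] [Finite U] (h2 : (2 : F) ≠ 0) (R : AdditivePoly F)
    (hU : R.IsTotallyIsotropic p U) :
    ∃ (Δ : F[X]) (B : F →+ F →+ F), (∀ x y, B x y = B y x) ∧ (∀ x, 2 * Δ.eval x = B x x) ∧
      ∀ x, ∀ β ∈ U, B x β = R.f p x β := by
  have : Module.Finite (ZMod p) U := Module.Finite.of_finite
  let b := Module.finBasis (ZMod p) U
  obtain ⟨l, hl⟩ := exists_dual_additivePoly (b := fun i => (b i : F))
    (b.linearIndependent.map' U.subtype (Submodule.ker_subtype U))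
  have hsymm : ∀ i j, R.f p (b i : F) (b j : F) = R.f p (b j : F) (b i : F) := fun i j =>
    sub_eq_zero.mp (hU _ (b i).2 _ (b j).2)
  let B₀ : F → F → F := fun x y =>
    ∑ i, R.f p x (b i : F) * (l i).poly.eval y + ∑ i, R.f p y (b i : F) * (l i).poly.eval x -
      ∑ i, ∑ j, R.f p (b i : F) (b j : F) * (l i).poly.eval x * (l j).poly.eval y
  have hB₀symm : ∀ x y, B₀ x y = B₀ y x := by
    intro x y
    have : ∑ i, ∑ j, R.f p (b i : F) (b j : F) * (l i).poly.eval x * (l j).poly.eval y =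
        ∑ i, ∑ j, R.f p (b i : F) (b j : F) * (l i).poly.eval y * (l j).poly.eval x := by
      rw [Finset.sum_comm]
      refine Finset.sum_congr rfl fun i _ => Finset.sum_congr rfl fun j _ => ?_
      rw [hsymm j i]
      ring
    simp only [B₀]
    rw [this]
    ring
  have hB₀add : ∀ x y y', B₀ x (y + y') = B₀ x y + B₀ x y' := by
    intro x y y'
    simp only [B₀, AdditivePoly.eval_add, R.f_add_left p, mul_add, add_mul, Finset.sum_add_distrib]
    ring
  let B : F →+ F →+ F := AddMonoidHom.mk' (fun x => AddMonoidHom.mk' (B₀ x) (hB₀add x))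
    fun x x' => by
      ext y
      change B₀ (x + x') y = B₀ x y + B₀ x' y
      rw [hB₀symm, hB₀add, hB₀symm y, hB₀symm y]
  refine ⟨∑ i, R.f p X (C (b i : F)) * (l i).poly -
    C 2⁻¹ * ∑ i, ∑ j, C (R.f p (b i : F) (b j : F)) * (l i).poly * (l j).poly, B, hB₀symm,
    fun x => ?_, fun x β hβ => ?_⟩
  · change _ = B₀ x x
    simp only [B₀, eval_sub, eval_finsetSum, eval_mul, eval_C, eval_f_X_C]
    rw [mul_sub, mul_inv_cancel_left₀ h2]
    ring
  · refine eq_on_of_eq_on_basis (g := B x) (h := R.fHom p x) b (fun k => ?_) hβ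
    change B₀ x (b k) = R.f p x (b k)
    simp only [B₀, hl, mul_ite, mul_one, mul_zero, Finset.sum_ite_eq', Finset.mem_univ, if_true]
    rw [Finset.sum_congr rfl fun i _ => congrArg (· * (l i).poly.eval x) (hsymm i k)]
    ring

/-- Descent along `r = vanishingPoly U`: `x R(x) = r(x) R₁(r(x)) + Δ(x) ^ p - Δ(x)`, where the
function `a - Δ(x)` on the curve `a ^ p - a = x R(x)` is invariant under the elements
`(β, f_R(β, β) / 2)`, `β ∈ U`, of `H_R`. -/
theorem exists_descent [IsAlgClosed F] [Fintype U] (hp2 : p ≠ 2) (R : AdditivePoly F)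
    (hUV : U ≤ R.V p) (hU : R.IsTotallyIsotropic p U) :
    ∃ (R₁ : AdditivePoly F) (Δ : F[X]), Δ.eval 0 = 0 ∧
      X * R.poly = vanishingPoly U * R₁.poly.comp (vanishingPoly U) + Δ ^ p - Δ ∧
      ∀ β ∈ U, ∀ x, Δ.eval (x + β) = Δ.eval x + R.f p x β + R.f p β β / 2 := by
  have : Infinite F := IsAlgClosed.instInfinite
  have h2 := two_ne_zero_of_charP hp2 F
  obtain ⟨Δ, B, hsymm, hdiag, hBU⟩ := R.exists_symmetric_extension h2 hU
  set r := vanishingPoly U with hr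
  have hΔ0 : Δ.eval 0 = 0 := by
    have := hdiag 0
    rw [map_zero] at this
    exact (mul_eq_zero.mp this).resolve_left h2
  have hΔ : ∀ β ∈ U, ∀ x, Δ.eval (x + β) = Δ.eval x + R.f p x β + R.f p β β / 2 := by
    intro β hβ x
    have h1 := hdiag (x + β)
    simp only [map_add, AddMonoidHom.add_apply] at h1
    rw [hsymm β x, hBU x β hβ, hBU β β hβ, ← hdiag x] at h1
    apply mul_left_cancel₀ h2
    rw [h1]
    field_simp
    ring
  set N : F[X] := X * R.poly - Δ ^ p + Δ with hN
  have hNquad : IsQuadraticPoly N := by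
    have hΔq : IsQuadraticPoly Δ := ⟨B, hdiag⟩
    have hX : IsQuadraticPoly (X * R.poly) :=
      IsQuadraticPoly.mul_of_additive ⟨X, by simp [IsAdditivePoly]⟩ R
    exact (hX.sub hΔq.pow_char).add hΔq
  have hNinv : ∀ β ∈ U, ∀ x, N.eval (x + β) = N.eval x := by
    intro β hβ x
    have h1 := R.f_pow_sub p x β
    have h3 := R.f_pow_sub p β β
    rw [show aeval β (R.E p) = 0 from hUV hβ] at h1 h3
    simp only [coe_aeval_eq_eval] at h1 h3
    obtain ⟨w, hw⟩ : ∃ w, R.f p β β = 2 * w := ⟨R.f p β β / 2, by field_simp⟩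
    have h4 : (2 : F) ^ p = 2 := map_ofNat (frobenius F p) 2
    rw [hw, mul_pow, h4] at h3
    apply mul_left_cancel₀ h2
    simp only [hN, Polynomial.eval_add, eval_sub, eval_mul, eval_X, eval_pow, R.eval_add,
      hΔ β hβ, add_pow_char, hw, mul_div_cancel_left₀ _ h2]
    linear_combination -2 * h1 - h3
  obtain ⟨M, hM⟩ := exists_eq_comp_vanishingPoly U N hNinv
  have hsurj : Function.Surjective r.eval :=
    IsAlgClosed.eval_surjective (by rw [hr, vanishingPoly_natDegree]; exact Fintype.card_ne_zero)
  have hMr : ∀ x, M.eval (r.eval x) = N.eval x := fun x => by rw [hM, eval_comp]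
  have hradd : ∀ x y, r.eval x + r.eval y = r.eval (x + y) := fun x y =>
    (vanishingPoly_eval_add U x y).symm
  have hrneg : ∀ x, -r.eval x = r.eval (-x) := fun x => by
    have h1 := hradd x (-x)
    rw [add_neg_cancel, (vanishingPoly_eval_eq_zero_iff U 0).mpr U.zero_mem] at h1
    linear_combination -h1
  -- `M` inherits the quadratic property from `N = M ∘ r` since `r` is additive and surjective.
  have hMcoeff : ∀ j, M.coeff j ≠ 0 → ∃ a b, j = p ^ a + p ^ b := fun j hj => by
    refine exists_eq_pow_add_pow_of_coeff_ne_zero hp2 (fun s => ?_) (fun s t u => ?_) hj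
    · obtain ⟨x, rfl⟩ := hsurj s
      simp only [hrneg, hMr, hNquad.eval_neg h2]
    · obtain ⟨x, rfl⟩ := hsurj s
      obtain ⟨y, rfl⟩ := hsurj t
      obtain ⟨z, rfl⟩ := hsurj u
      simp only [hradd, hMr, hNquad.polar_add h2]
  obtain ⟨R₁, D, hD0, hD⟩ := exists_additivePoly_add_pow_sub hMcoeff
  refine ⟨R₁, Δ + D.comp r, ?_, ?_, fun β hβ x => ?_⟩
  · rw [Polynomial.eval_add, eval_comp, (vanishingPoly_eval_eq_zero_iff U 0).mpr U.zero_mem, hΔ0,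
      hD0, add_zero]
  · rw [hD] at hM
    simp only [sub_comp, add_comp, mul_comp, X_comp, pow_comp] at hM
    rw [add_pow_char]
    linear_combination hM
  · simp only [Polynomial.eval_add, eval_comp, hΔ β hβ,
      show r.eval (x + β) = r.eval x from vanishingPoly_eval_add_of_mem U hβ x]
    ring

end AdditivePoly

/-! ### Degrees modulo Artin–Schreier polynomials -/

/-- A polynomial of degree less than `p ^ (M + 1)` in which `x ^ (p ^ M + 1)` occurs is not of the
form `D ^ p - D`: such a `D` has degree less than `p ^ M`, and the exponents in `D ^ p` are
multiples of `p`. -/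
theorem ne_pow_sub_self_of_coeff_ne_zero {p : ℕ} [hp : Fact p.Prime] {F : Type u} [Field F]
    [CharP F p] {M : ℕ} (hM : M ≠ 0) {G : F[X]} (hdeg : G.natDegree < p ^ (M + 1))
    (hG : G.coeff (p ^ M + 1) ≠ 0) (D : F[X]) : G ≠ D ^ p - D := by
  rintro rfl
  have h1 : (D ^ p).coeff (p ^ M + 1) = 0 := by
    have hdvd : ¬ p ∣ p ^ M + 1 := fun h =>
      hp.out.one_lt.ne' (Nat.dvd_one.mp ((Nat.dvd_add_right (dvd_pow_self p hM)).mp h))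
    rw [← map_frobenius_expand p, coeff_map, coeff_expand hp.out.pos, if_neg hdvd, map_zero]
  have hD : D.coeff (p ^ M + 1) ≠ 0 := by
    intro h
    rw [coeff_sub, h1, h, sub_zero] at hG
    exact hG rfl
  have hDdeg : p ^ M + 1 ≤ D.natDegree := le_natDegree_of_ne_zero hD
  have h2 : (D ^ p - D).natDegree = p * D.natDegree := by
    rw [natDegree_sub_eq_left_of_natDegree_lt, natDegree_pow]
    rw [natDegree_pow]
    exact lt_mul_of_one_lt_left (by omega) hp.out.one_lt
  rw [h2, pow_succ'] at hdeg
  have := lt_of_mul_lt_mul_left hdeg (Nat.zero_le p)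
  omega

namespace AdditivePoly

variable {p : ℕ} [hp : Fact p.Prime] {F : Type u} [Field F] [CharP F p]

theorem exists_natDegree_eq_pow (p : ℕ) [Fact p.Prime] [CharP F p] (R : AdditivePoly F)
    (h : R.poly ≠ 0) : ∃ s, R.poly.natDegree = p ^ s := by
  by_contra hs
  push Not at hs
  exact h (leadingCoeff_eq_zero.mp (R.coeff_eq_zero (p := p) _ hs))

theorem derivative_poly (p : ℕ) [hp : Fact p.Prime] [CharP F p] (R : AdditivePoly F) :
    derivative R.poly = C (R.poly.coeff 1) := by
  ext i
  rw [coeff_derivative, coeff_C]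
  split_ifs with hi
  · simp [hi]
  by_cases hpow : ∃ j, i + 1 = p ^ j
  · obtain ⟨j, hj⟩ := hpow
    have hj0 : j ≠ 0 := by
      rintro rfl
      exact hi (by simpa using hj)
    have : ((i : F) + 1) = 0 := by
      have h := congrArg (Nat.cast : ℕ → F) hj
      push_cast at h
      rw [h, CharP.cast_eq_zero, zero_pow hj0]
    rw [this, mul_zero]
  · push Not at hpow
    rw [R.coeff_eq_zero (p := p) _ hpow, zero_mul]

theorem coeff_one_ne_zero_of_separable (p : ℕ) [Fact p.Prime] [CharP F p] (r : AdditivePoly F)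
    (hr : r.poly.Separable) (hd : r.poly.natDegree ≠ 0) : r.poly.coeff 1 ≠ 0 := by
  intro h
  rw [Polynomial.Separable, r.derivative_poly p, h, C_0, isCoprime_zero_right] at hr
  exact hd (natDegree_eq_zero_of_isUnit hr)

variable {r Q : AdditivePoly F} {n s : ℕ}

theorem natDegree_mul_comp (hr : r.poly.natDegree = p ^ n) (hQ : Q.poly.natDegree = p ^ s) :
    (r.poly * Q.poly.comp r.poly).natDegree = p ^ n + p ^ (n + s) := by
  have hp0 : ∀ i, p ^ i ≠ 0 := fun i => (pow_pos hp.out.pos i).ne'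
  have h1 : (Q.poly.comp r.poly).natDegree = p ^ (n + s) := by
    rw [natDegree_comp, hr, hQ, pow_add, mul_comm]
  rw [natDegree_mul, hr, h1]
  · exact ne_zero_of_natDegree_gt (n := 0) (by rw [hr]; exact Nat.pos_of_ne_zero (hp0 n))
  · exact ne_zero_of_natDegree_gt (n := 0) (by rw [h1]; exact Nat.pos_of_ne_zero (hp0 _))

/-- For separable `r`, the monomial `x ^ (p ^ (n + s) + 1)` occurs in `r(x) Q(r(x))`. -/
theorem coeff_mul_comp_ne_zero (hp2 : p ≠ 2) (hmon : r.poly.Monic) (hsep : r.poly.Separable)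
    (hn : n ≠ 0) (hr : r.poly.natDegree = p ^ n) (hQ : Q.poly.natDegree = p ^ s) :
    (r.poly * Q.poly.comp r.poly).coeff (p ^ (n + s) + 1) ≠ 0 := by
  have hp0 : ∀ i, p ^ i ≠ 0 := fun i => (pow_pos hp.out.pos i).ne'
  have h2 := two_ne_zero_of_charP hp2 F
  have hr0 : r.poly.coeff 1 ≠ 0 :=
    r.coeff_one_ne_zero_of_separable p hsep (by rw [hr]; exact hp0 n)
  have hQ0 : Q.poly.coeff (p ^ s) ≠ 0 := by
    rw [← hQ]
    exact leadingCoeff_ne_zero.mpr (ne_zero_of_natDegree_gt (n := 0)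
      (by rw [hQ]; exact Nat.pos_of_ne_zero (hp0 s)))
  have h1 : (Q.poly.comp r.poly).coeff (p ^ (n + s)) = Q.poly.coeff (p ^ s) := by
    have : (Q.poly.comp r.poly).natDegree = p ^ (n + s) := by
      rw [natDegree_comp, hr, hQ, pow_add, mul_comm]
    rw [← this, coeff_natDegree, leadingCoeff_comp (by rw [hr]; exact hp0 n), hmon.leadingCoeff,
      one_pow, mul_one, leadingCoeff, hQ]
  have h3 := congrArg (fun G => G.coeff (p ^ (n + s)))
    (derivative_mul (f := r.poly) (g := Q.poly.comp r.poly))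
  simp only [coeff_derivative, derivative_comp, r.derivative_poly p, Q.derivative_poly p, C_comp,
    coeff_add, coeff_C_mul, coeff_mul_C, ← mul_assoc, h1, Nat.cast_pow, CharP.cast_eq_zero,
    zero_pow (show n + s ≠ 0 by omega), zero_add, mul_one] at h3
  rw [h3]
  rcases Nat.eq_zero_or_pos s with rfl | hs
  · have : r.poly.coeff (p ^ n) = 1 := by rw [← hr]; exact hmon
    rw [add_zero, this]
    rw [pow_zero] at hQ0 ⊢
    have := mul_ne_zero h2 (mul_ne_zero hr0 hQ0)
    convert this using 1
    ring
  · rw [coeff_eq_zero_of_natDegree_lt (p := r.poly) (n := p ^ (n + s))]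
    · simpa using ⟨hr0, hQ0⟩
    · rw [hr]
      exact Nat.pow_lt_pow_right hp.out.one_lt (by omega)

theorem add_pow_lt (hp2 : p ≠ 2) (n s : ℕ) : p ^ n + p ^ (n + s) < p ^ (n + s + 1) := by
  have h3 : 3 ≤ p := by
    have := hp.out.two_le
    omega
  have h1 : p ^ n ≤ p ^ (n + s) := Nat.pow_le_pow_right hp.out.pos (by omega)
  have h2 : 0 < p ^ (n + s) := pow_pos hp.out.pos _
  rw [pow_succ]
  nlinarith

/-- If `r(x) Q(r(x))` is of the form `D ^ p - D`, then `Q = 0`. -/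
theorem eq_zero_of_mul_comp_eq_pow_sub (hp2 : p ≠ 2) (hmon : r.poly.Monic)
    (hsep : r.poly.Separable) (hn : n ≠ 0) (hr : r.poly.natDegree = p ^ n) {D : F[X]}
    (h : r.poly * Q.poly.comp r.poly = D ^ p - D) : Q.poly = 0 := by
  by_contra hQ
  obtain ⟨s, hs⟩ := Q.exists_natDegree_eq_pow p hQ
  refine ne_pow_sub_self_of_coeff_ne_zero (M := n + s) (by omega) ?_
    (coeff_mul_comp_ne_zero hp2 hmon hsep hn hr hs) D h
  rw [natDegree_mul_comp hr hs]
  exact add_pow_lt hp2 n s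

/-- Comparison of degrees in `x P(x) = r(x) Q(r(x)) + D(x) ^ p - D(x)`. -/
theorem natDegree_descent (hp2 : p ≠ 2) (hmon : r.poly.Monic) (hsep : r.poly.Separable)
    (hn : n ≠ 0) (hr : r.poly.natDegree = p ^ n) {P : AdditivePoly F} {e : ℕ} (he : e ≠ 0)
    (hP : P.poly.natDegree = p ^ e) {D : F[X]}
    (h : X * P.poly = r.poly * Q.poly.comp r.poly + D ^ p - D) :
    ∃ s, Q.poly.natDegree = p ^ s ∧ e = n + s := by
  have hG : X * P.poly - r.poly * Q.poly.comp r.poly = D ^ p - D := by rw [h]; ring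
  have hP0 : P.poly ≠ 0 := ne_zero_of_natDegree_gt (n := 0) (by
    rw [hP]; exact pow_pos hp.out.pos _)
  have hXP : (X * P.poly).natDegree = p ^ e + 1 := by rw [natDegree_X_mul hP0, hP]
  have hXPc : (X * P.poly).coeff (p ^ e + 1) ≠ 0 := by
    rw [coeff_X_mul, ← hP]
    exact leadingCoeff_ne_zero.mpr hP0
  have hlt : p ^ e + 1 < p ^ (e + 1) := by simpa [add_comm] using add_pow_lt hp2 0 e
  by_cases hQ : Q.poly = 0
  · rw [hQ, zero_comp, mul_zero, sub_zero] at hG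
    exact absurd hG (ne_pow_sub_self_of_coeff_ne_zero he (by rwa [hXP]) hXPc D)
  obtain ⟨s, hs⟩ := Q.exists_natDegree_eq_pow p hQ
  refine ⟨s, hs, ?_⟩
  have hdeg := natDegree_mul_comp hr hs
  have hc := coeff_mul_comp_ne_zero hp2 hmon hsep hn hr hs
  have hlt' := add_pow_lt (p := p) hp2 n s
  rcases lt_trichotomy e (n + s) with hes | hes | hes
  · have hle : p ^ (e + 1) ≤ p ^ (n + s) := Nat.pow_le_pow_right hp.out.pos hes
    refine absurd hG (ne_pow_sub_self_of_coeff_ne_zero (M := n + s) (by omega) ?_ ?_ D)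
    · refine lt_of_le_of_lt (natDegree_sub_le _ _) (max_lt ?_ (by rwa [hdeg]))
      rw [hXP]
      omega
    · rw [coeff_sub, coeff_eq_zero_of_natDegree_lt (p := X * P.poly) (by rw [hXP]; omega),
        zero_sub]
      exact neg_ne_zero.mpr hc
  · exact hes
  · have hle : p ^ (n + s + 1) ≤ p ^ e := Nat.pow_le_pow_right hp.out.pos hes
    refine absurd hG (ne_pow_sub_self_of_coeff_ne_zero (M := e) he ?_ ?_ D)
    · refine lt_of_le_of_lt (natDegree_sub_le _ _) (max_lt (by rwa [hXP]) ?_)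
      rw [hdeg]
      omega
    · rw [coeff_sub, coeff_eq_zero_of_natDegree_lt
        (p := r.poly * Q.poly.comp r.poly) (by rw [hdeg]; omega), sub_zero]
      exact hXPc

/-! ### The scaling action and the divisibility of `d_{R₁}` -/

theorem dm_dvd_pow_add_one (R : AdditivePoly F) (m : ℕ) {i : ℕ} (hi : R.poly.coeff (p ^ i) ≠ 0) :
    R.dm p m ∣ p ^ i + 1 := by
  classical
  refine (Nat.div_dvd_of_dvd (Nat.gcd_dvd_left _ _)).trans ?_
  refine Finset.gcd_dvd (Finset.mem_filter.mpr ⟨?_, hi⟩)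
  have h1 : p ^ i ≤ R.poly.natDegree := le_natDegree_of_ne_zero hi
  rw [Finset.mem_range, Nat.lt_succ_iff]
  exact Nat.le_log_of_pow_le hp.out.one_lt h1

/-- The polynomial `x R(x)` is invariant under `x ↦ α x` for `α ∈ μ_{d_{R,m}}`. -/
theorem scale_mul_poly (R : AdditivePoly F) {m : ℕ} {α : F} (hα : α ^ R.dm p m = 1) :
    C α * X * R.poly.comp (C α * X) = X * R.poly := by
  have h : R.poly.comp (C α * X) * C α = R.poly := by
    ext j
    rw [coeff_mul_C, comp_C_mul_X_coeff]
    by_cases hj : R.poly.coeff j = 0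
    · simp [hj]
    obtain ⟨i, rfl⟩ : ∃ i, j = p ^ i := by
      by_contra hpow
      push Not at hpow
      exact hj (R.coeff_eq_zero (p := p) j hpow)
    obtain ⟨c, hc⟩ := R.dm_dvd_pow_add_one m hj
    rw [mul_assoc, ← pow_succ, hc, pow_mul, hα, one_pow, mul_one]
  calc C α * X * R.poly.comp (C α * X) = X * (R.poly.comp (C α * X) * C α) := by ring
    _ = _ := by rw [h]

/-- For `α ∈ μ_{d_{R,m}}`, the additive polynomial `Q(t) = α R₁(α t) - R₁(t)` satisfies
`r(x) Q(r(x)) = D(x) ^ p - D(x)` for some `D`, hence `Q = 0`. -/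
theorem dm_dvd_d_of_descent [IsAlgClosed F] (hp2 : p ≠ 2) (hmon : r.poly.Monic)
    (hsep : r.poly.Separable) (hn : n ≠ 0) (hr : r.poly.natDegree = p ^ n) {R R₁ : AdditivePoly F}
    {e : ℕ} (he : e ≠ 0) (hR : R.poly.natDegree = p ^ e) {m : ℕ}
    (hscale : ∀ α : F, α ^ R.dm p m = 1 → r.poly.comp (C α * X) = C α * r.poly) {Δ : F[X]}
    (h : X * R.poly = r.poly * R₁.poly.comp r.poly + Δ ^ p - Δ) : R.dm p m ∣ R₁.d p := by
  have hdvd : R.dm p m ∣ p ^ e + 1 := by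
    refine R.dm_dvd_pow_add_one m ?_
    rw [← hR]
    exact leadingCoeff_ne_zero.mpr (ne_zero_of_natDegree_gt (n := 0) (by
      rw [hR]; exact pow_pos hp.out.pos _))
  have hd : (R.dm p m : F) ≠ 0 := by
    rw [Ne, CharP.cast_eq_zero_iff F p]
    exact fun hpd => hp.out.one_lt.ne'
      (Nat.dvd_one.mp ((Nat.dvd_add_right (dvd_pow_self p he)).mp (hpd.trans hdvd)))
  have : NeZero (R.dm p m : F) := ⟨hd⟩
  obtain ⟨α, hα⟩ := HasEnoughRootsOfUnity.exists_primitiveRoot F (R.dm p m)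
  let Q : AdditivePoly F := ⟨C α * R₁.poly.comp (C α * X) - R₁.poly,
    haveI : Infinite F := IsAlgClosed.instInfinite
    isAdditivePoly_of_eval_add fun x y => by
      simp only [eval_sub, eval_mul, eval_C, eval_comp, eval_X, mul_add, R₁.eval_add]
      ring⟩
  have hQ : Q.poly = 0 := by
    refine eq_zero_of_mul_comp_eq_pow_sub (D := Δ - Δ.comp (C α * X)) hp2 hmon hsep hn hr ?_
    have h1 := congrArg (fun G => G.comp (C α * X)) h
    simp only [mul_comp, X_comp, sub_comp, add_comp, pow_comp, R.scale_mul_poly hα.pow_eq_one,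
      comp_assoc, hscale α hα.pow_eq_one] at h1
    have h2 : Q.poly.comp r.poly = C α * R₁.poly.comp (C α * r.poly) - R₁.poly.comp r.poly := by
      simp only [Q, sub_comp, mul_comp, C_comp, comp_assoc, X_comp]
    rw [h2, sub_pow_char]
    linear_combination h - h1
  classical
  refine Finset.dvd_gcd fun i hi => ?_
  have hi' : R₁.poly.coeff (p ^ i) ≠ 0 := (Finset.mem_filter.mp hi).2
  have h3 := congrArg (fun G => G.coeff (p ^ i)) hQ
  simp only [Q, coeff_sub, coeff_C_mul, comp_C_mul_X_coeff, coeff_zero] at h3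
  rw [← hα.pow_eq_one_iff_dvd]
  apply mul_left_cancel₀ hi'
  rw [pow_succ]
  linear_combination h3

end AdditivePoly

/-! ### The subgroup of `H_R` defined by a totally isotropic subspace -/

namespace AdditivePoly

variable {p : ℕ} [hp : Fact p.Prime] {F : Type u} [Field F] [CharP F p] [Algebra (ZMod p) F]

/-- The homomorphic section `β ↦ (1, β, f_R(β, β) / 2)` of `H_R → V_R` over a totally isotropic
subspace `U` of `V_R`. -/
noncomputable def isotropicSection (hp2 : p ≠ 2) (R : AdditivePoly F) {U : Submodule (ZMod p) F}
    (hUV : U ≤ R.V p) (hU : R.IsTotallyIsotropic p U) : Multiplicative U →* H p R :=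
  MonoidHom.mk'
    (fun u =>
      { β := (u.toAdd : F)
        γ := R.f p (u.toAdd : F) (u.toAdd : F) / 2
        E_eq_zero := hUV u.toAdd.2
        pow_sub := by
          have h2 := two_ne_zero_of_charP hp2 F
          have h2p : (2 : F) ^ p = 2 := map_ofNat (frobenius F p) 2
          have h1 := R.f_pow_sub p (u.toAdd : F) (u.toAdd : F)
          rw [show aeval (u.toAdd : F) (R.E p) = 0 from hUV u.toAdd.2] at h1
          rw [div_pow, h2p]
          field_simp
          linear_combination h1 })
    (fun u v => by
      have h2 := two_ne_zero_of_charP hp2 F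
      have h1 : R.f p (u.toAdd : F) (v.toAdd : F) = R.f p (v.toAdd : F) (u.toAdd : F) :=
        sub_eq_zero.mp (hU _ u.toAdd.2 _ v.toAdd.2)
      apply H.ext
      · rfl
      · change R.f p ((u.toAdd : F) + v.toAdd) ((u.toAdd : F) + v.toAdd) / 2 =
          R.f p (u.toAdd : F) u.toAdd / 2 + R.f p (v.toAdd : F) v.toAdd / 2 +
            R.f p (u.toAdd : F) v.toAdd
        rw [R.f_add_left p, R.f_add_right p, R.f_add_right p, ← h1]
        field_simp
        ring)

variable (hp2 : p ≠ 2) (R : AdditivePoly F) {U : Submodule (ZMod p) F}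
    (hUV : U ≤ R.V p) (hU : R.IsTotallyIsotropic p U)

theorem f_smul_smul (ξ : ZMod p) (x : F) : R.f p (ξ • x) (ξ • x) = ξ ^ 2 • R.f p x x := by
  have h1 : ∀ y z : F, R.f p y (ξ • z) = ξ • R.f p y z := fun y z =>
    ZMod.map_smul (R.fHom p y) ξ z
  have h2 : ∀ y z : F, R.f p (ξ • y) z = ξ • R.f p y z := fun y z =>
    ZMod.map_smul ((R.fHom p).flip z) ξ y
  rw [h1, h2, smul_smul, sq]

theorem line_eq_image {g : H p R} {u : U} (hβ : g.β = u) (hγ : g.γ = R.f p (u : F) (u : F) / 2) :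
    H.line g = Set.range fun ξ : ZMod p =>
      R.isotropicSection hp2 hUV hU (Multiplicative.ofAdd (ξ • u)) := by
  have key : ∀ ξ : ZMod p, R.f p (ξ • (u : F)) (ξ • (u : F)) / 2 = ξ ^ 2 • g.γ := fun ξ => by
    rw [f_smul_smul, hγ, smul_div_assoc]
  ext h
  constructor
  · rintro ⟨ξ, h1, h2⟩
    refine ⟨ξ, H.ext ?_ ?_⟩
    · rw [h1, hβ]
      rfl
    · rw [h2, ← key]
      rfl
  · rintro ⟨ξ, rfl⟩
    refine ⟨ξ, ?_, ?_⟩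
    · rw [hβ]
      rfl
    · rw [← key]
      rfl

theorem coe_range_isotropicSection {n : ℕ} (b : Module.Basis (Fin n) (ZMod p) U)
    {g : Fin n → H p R}
    (hg : ∀ i, (g i).β = (b i : F) ∧ (g i).γ = R.f p (b i : F) (b i : F) / 2) :
    ((R.isotropicSection hp2 hUV hU).range : Set (H p R)) =
      (List.ofFn fun i => H.line (g i)).prod := by
  have hline := fun i => R.line_eq_image hp2 hUV hU (hg i).1 (hg i).2
  ext h
  rw [Set.mem_prod_list_ofFn]
  constructor
  · rintro ⟨u, rfl⟩
    refine ⟨fun i => ⟨R.isotropicSection hp2 hUV hU (Multiplicative.ofAdd (b.repr u.toAdd i • b i)),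
      by rw [hline]; exact ⟨_, rfl⟩⟩, ?_⟩
    have h1 : u = (List.ofFn fun i => Multiplicative.ofAdd (b.repr u.toAdd i • b i)).prod := by
      rw [List.prod_ofFn, ← ofAdd_sum, b.sum_repr]
      rfl
    conv_rhs => rw [h1]
    rw [map_list_prod, List.map_ofFn]
    rfl
  · rintro ⟨f, rfl⟩
    refine Subgroup.list_prod_mem _ fun x hx => ?_
    obtain ⟨i, rfl⟩ := (List.mem_ofFn' _ _).mp hx
    obtain ⟨ξ, hξ⟩ := (hline i).subset (f i).2
    exact ⟨_, hξ⟩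

end AdditivePoly

/-! ### The ring of invariants -/

namespace AdditivePoly

variable {p : ℕ} [hp : Fact p.Prime] {F : Type u} [Field F] [CharP F p] (R : AdditivePoly F)

theorem pointHom_aC {A : Type v} [CommRing A] [Algebra F A] (s t : A)
    (h : s ^ p - s = t * aeval t R.poly) : R.pointHom p s t h (R.aC p) = s := by
  simp [pointHom, aC]

theorem pointHom_xC {A : Type v} [CommRing A] [Algebra F A] (s t : A)
    (h : s ^ p - s = t * aeval t R.poly) : R.pointHom p s t h (R.xC p) = t := by
  simp [pointHom, xC]

theorem pointHom_mk_C {A : Type v} [CommRing A] [Algebra F A] (s t : A)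
    (h : s ^ p - s = t * aeval t R.poly) (P : F[X]) :
    R.pointHom p s t h (AdjoinRoot.mk _ (C P)) = aeval t P := by
  rw [AdjoinRoot.mk_C]
  simp [pointHom]

theorem mem_invariants (G : Subgroup (H p R)) (z : CoordRing p R) :
    z ∈ R.invariants p G ↔ ∀ g ∈ G, R.actHom p g z = z := by
  simp [invariants, Algebra.mem_iInf, AlgHom.mem_equalizer]

theorem artinSchreier_monic_natDegree {A : Type*} [CommRing A] [Nontrivial A] (c : A) :
    (X ^ p - X - C c : A[X]).Monic ∧ (X ^ p - X - C c : A[X]).natDegree = p := by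
  have hlt : (X + C c : A[X]).degree < p := by
    rw [degree_X_add_C]
    exact_mod_cast hp.out.one_lt
  rw [sub_sub]
  exact ⟨monic_X_pow_sub hlt, by
    rw [natDegree_sub_eq_left_of_natDegree_lt] <;> simp [hp.out.one_lt]⟩

/-- Evaluation of polynomials in the variable `a - Δ(x)` on the curve `C_R`. -/
noncomputable def shiftHom (p : ℕ) (R : AdditivePoly F) (Δ : F[X]) :
    F[X][X] →+* CoordRing p R :=
  (AdjoinRoot.mk _).comp (compRingHom (X - C Δ))

theorem shiftHom_X (Δ : F[X]) : R.shiftHom p Δ X = R.aC p - aeval (R.xC p) Δ := by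
  simp [shiftHom, aC, aeval_xC]

theorem shiftHom_C (Δ P : F[X]) : R.shiftHom p Δ (C P) = aeval (R.xC p) P := by
  simp [shiftHom, aeval_xC]

theorem comp_X_sub_C_comp_X_add_C {A : Type*} [CommRing A] (G : A[X]) (c : A) :
    (G.comp (X + C c)).comp (X - C c) = G := by
  simp [comp_assoc]

theorem comp_X_add_C_comp_X_sub_C {A : Type*} [CommRing A] (G : A[X]) (c : A) :
    (G.comp (X - C c)).comp (X + C c) = G := by
  simp [comp_assoc]

variable {Q Δ : F[X]} (hQ : X * R.poly = Q + Δ ^ p - Δ)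
include hQ

theorem shiftHom_eq_zero_iff (G : F[X][X]) :
    R.shiftHom p Δ G = 0 ↔ (X ^ p - X - C Q : F[X][X]) ∣ G := by
  have h1 : (X ^ p - X - C Q : F[X][X]).comp (X - C Δ) = X ^ p - X - C (X * R.poly) := by
    simp only [sub_comp, X_pow_comp, X_comp, C_comp, sub_pow_char, hQ, C_add, C_sub, C_pow]
    ring
  rw [show R.shiftHom p Δ G = AdjoinRoot.mk _ (G.comp (X - C Δ)) from rfl, AdjoinRoot.mk_eq_zero,
    ← h1]
  constructor
  · rintro ⟨K, hK⟩
    refine ⟨K.comp (X + C Δ), ?_⟩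
    have := congrArg (fun P => P.comp (X + C Δ)) hK
    simpa only [mul_comp, comp_X_add_C_comp_X_sub_C] using this
  · rintro ⟨K, rfl⟩
    exact ⟨K.comp (X - C Δ), by rw [mul_comp]⟩

/-- The powers `(a - Δ(x)) ^ i`, `i < p`, generate the coordinate ring over `F[x]`. -/
theorem exists_shiftHom_eq (z : CoordRing p R) :
    ∃ G : F[X][X], G.natDegree < p ∧ R.shiftHom p Δ G = z := by
  obtain ⟨G, rfl⟩ := AdjoinRoot.mk_surjective z
  obtain ⟨hmon, hdeg⟩ := artinSchreier_monic_natDegree (p := p) Q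
  refine ⟨(G.comp (X + C Δ)) %ₘ (X ^ p - X - C Q), ?_, ?_⟩
  · have := natDegree_modByMonic_lt (G.comp (X + C Δ)) hmon (fun h => by
      rw [h, natDegree_one] at hdeg
      exact hp.out.ne_zero hdeg.symm)
    rwa [hdeg] at this
  · have h0 : R.shiftHom p Δ (X ^ p - X - C Q) = 0 := (R.shiftHom_eq_zero_iff hQ _).mpr dvd_rfl
    rw [modByMonic_eq_sub_mul_div, map_sub (R.shiftHom p Δ), map_mul (R.shiftHom p Δ), h0,
      zero_mul, sub_zero]
    change AdjoinRoot.mk _ ((G.comp (X + C Δ)).comp (X - C Δ)) = _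
    rw [comp_X_sub_C_comp_X_add_C]

/-- The powers `(a - Δ(x)) ^ i`, `i < p`, are linearly independent over `F[x]`. -/
theorem eq_zero_of_shiftHom_eq_zero {G : F[X][X]} (hG : G.natDegree < p)
    (h : R.shiftHom p Δ G = 0) : G = 0 := by
  obtain ⟨hmon, hdeg⟩ := artinSchreier_monic_natDegree (p := p) Q
  by_contra h0
  exact hmon.not_dvd_of_natDegree_lt h0 (by rwa [hdeg]) ((R.shiftHom_eq_zero_iff hQ G).mp h)

end AdditivePoly

namespace AdditivePoly

variable {p : ℕ} [hp : Fact p.Prime] {F : Type u} [Field F] [CharP F p]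

/-- An element `(1, β, f_R(β, β) / 2)` of `H_R` fixes `a - Δ(x)` and translates `x`. -/
theorem actHom_shiftHom (R : AdditivePoly F) [Infinite F] {Δ : F[X]} {g : H p R}
    (hγ : g.γ = R.f p g.β g.β / 2)
    (hΔ : ∀ x, Δ.eval (x + g.β) = Δ.eval x + R.f p x g.β + R.f p g.β g.β / 2) (G : F[X][X]) :
    R.actHom p g (R.shiftHom p Δ G) = R.shiftHom p Δ (G.map (taylorAlgHom g.β).toRingHom) := by
  have hx : ∀ P : F[X], R.actHom p g (aeval (R.xC p) P) = aeval (R.xC p) (taylor g.β P) := by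
    intro P
    rw [← Polynomial.aeval_algHom_apply, actHom, pointHom_xC, taylor_apply, aeval_comp]
    simp
  have ha : R.actHom p g (R.aC p - aeval (R.xC p) Δ) = R.aC p - aeval (R.xC p) Δ := by
    have hpoly : taylor g.β Δ = Δ + R.f p X (C g.β) + C g.γ := by
      refine Polynomial.funext fun x => ?_
      rw [taylor_eval, hΔ, Polynomial.eval_add, Polynomial.eval_add, eval_f_X_C, eval_C, hγ]
    rw [map_sub, hx, hpoly, map_add, map_add, map_f, aeval_X, aeval_C, actHom, pointHom_aC]
    rw [show aeval (R.xC p) (C g.γ) = algebraMap F (CoordRing p R) g.γ from aeval_C _ _]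
    ring
  suffices h : (R.actHom p g).toRingHom.comp (R.shiftHom p Δ) =
      (R.shiftHom p Δ).comp (mapRingHom (taylorAlgHom g.β).toRingHom) from RingHom.congr_fun h G
  refine Polynomial.ringHom_ext (fun P => ?_) ?_
  · simp only [RingHom.comp_apply, coe_mapRingHom, map_C, shiftHom_C]
    exact hx P
  · simp only [RingHom.comp_apply, coe_mapRingHom, map_X, shiftHom_X]
    exact ha

theorem pointHom_mk (R R₁ r : AdditivePoly F) {Δ : F[X]}
    (h : (R.aC p - aeval (R.xC p) Δ) ^ p - (R.aC p - aeval (R.xC p) Δ) =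
      aeval (R.xC p) r.poly * aeval (aeval (R.xC p) r.poly) R₁.poly) (G : F[X][X]) :
    R₁.pointHom p _ _ h (AdjoinRoot.mk _ G) =
      R.shiftHom p Δ (G.map (compRingHom r.poly)) := by
  suffices h : (R₁.pointHom p _ _ h).toRingHom.comp (AdjoinRoot.mk _) =
      (R.shiftHom p Δ).comp (mapRingHom (compRingHom r.poly)) from RingHom.congr_fun h G
  refine Polynomial.ringHom_ext (fun P => ?_) ?_
  · simp only [RingHom.comp_apply, coe_mapRingHom, map_C, shiftHom_C, coe_compRingHom_apply,
      aeval_comp]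
    exact R₁.pointHom_mk_C _ _ _ P
  · simp only [RingHom.comp_apply, coe_mapRingHom, map_X, shiftHom_X]
    exact R₁.pointHom_aC _ _ h

variable (hp2 : p ≠ 2) (R R₁ : AdditivePoly F) [Infinite F] [Algebra (ZMod p) F]
    {U : Submodule (ZMod p) F} [Fintype U]
    (hUV : U ≤ R.V p) (hU : R.IsTotallyIsotropic p U) {Δ : F[X]}
    (hdesc : X * R.poly = vanishingPoly U * R₁.poly.comp (vanishingPoly U) + Δ ^ p - Δ)
    (hΔ : ∀ β ∈ U, ∀ x, Δ.eval (x + β) = Δ.eval x + R.f p x β + R.f p β β / 2)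
    (h : (R.aC p - aeval (R.xC p) Δ) ^ p - (R.aC p - aeval (R.xC p) Δ) =
      aeval (R.xC p) (vanishingAdditivePoly U).poly *
        aeval (aeval (R.xC p) (vanishingAdditivePoly U).poly) R₁.poly)

include hdesc in
theorem pointHom_injective :
    Function.Injective (R₁.pointHom p _ _ h : CoordRing p R₁ →ₐ[F] CoordRing p R) := by
  have hdeg0 : (vanishingPoly U).natDegree ≠ 0 := by
    rw [vanishingPoly_natDegree]
    exact Fintype.card_ne_zero
  rw [injective_iff_map_eq_zero]
  intro z hz
  obtain ⟨G, hG, rfl⟩ := R₁.exists_shiftHom_eq (p := p) (Q := X * R₁.poly) (Δ := 0)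
    (by simp [hp.out.ne_zero]) z
  have hmk : R₁.shiftHom p 0 G = AdjoinRoot.mk _ G := by simp [shiftHom]
  rw [hmk, R.pointHom_mk R₁ (vanishingAdditivePoly U) h] at hz
  have h0 := R.eq_zero_of_shiftHom_eq_zero hdesc (natDegree_map_le.trans_lt hG) hz
  have hinj : Function.Injective (compRingHom (vanishingPoly U) : F[X] →+* F[X]) := by
    rw [injective_iff_map_eq_zero]
    intro P hP
    rw [coe_compRingHom_apply, comp_eq_zero_iff] at hP
    rcases hP with hP | ⟨-, hP⟩
    · exact hP
    · exact absurd (by rw [hP, natDegree_C]) hdeg0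
  rw [(Polynomial.map_eq_zero_iff hinj).mp h0, map_zero]

include hdesc hΔ in
/-- The functions on `C_R` that are invariant under the image of `U` in `H_R` are the functions of
`a - Δ(x)` and `r(x)`: invariance means that all coefficients with respect to the basis
`(a - Δ(x)) ^ i`, `i < p`, are invariant under the translations by `U`. -/
theorem pointHom_range :
    (R₁.pointHom p _ _ h : CoordRing p R₁ →ₐ[F] CoordRing p R).range =
      R.invariants p (R.isotropicSection hp2 hUV hU).range := by
  have hact : ∀ (u : U) (G : F[X][X]),
      R.actHom p (R.isotropicSection hp2 hUV hU (Multiplicative.ofAdd u)) (R.shiftHom p Δ G) =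
        R.shiftHom p Δ (G.map (taylorAlgHom (u : F)).toRingHom) := fun u G =>
    R.actHom_shiftHom (g := R.isotropicSection hp2 hUV hU (Multiplicative.ofAdd u)) rfl
      (hΔ u u.2) G
  ext z
  rw [mem_invariants]
  constructor
  · rintro ⟨y, rfl⟩ _ ⟨u, rfl⟩
    obtain ⟨G, rfl⟩ := AdjoinRoot.mk_surjective y
    change R.actHom p _ (R₁.pointHom p _ _ h _) = R₁.pointHom p _ _ h _
    rw [R.pointHom_mk R₁ (vanishingAdditivePoly U) h]
    refine (hact u.toAdd _).trans ?_
    rw [Polynomial.map_map]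
    congr 2
    refine RingHom.ext fun P => Polynomial.funext fun x => ?_
    change (taylor _ (P.comp (vanishingPoly U))).eval x = (P.comp (vanishingPoly U)).eval x
    rw [taylor_eval, eval_comp, eval_comp, vanishingPoly_eval_add_of_mem U u.toAdd.2]
  · intro hz
    obtain ⟨G, hG, rfl⟩ := R.exists_shiftHom_eq hdesc z
    have hinv : ∀ u : U, G.map (taylorAlgHom (u : F)).toRingHom = G := fun u => by
      have h1 := hz _ ⟨Multiplicative.ofAdd u, rfl⟩
      rw [hact] at h1
      refine sub_eq_zero.mp (R.eq_zero_of_shiftHom_eq_zero hdesc ?_ (by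
        rw [RingHom.map_sub, h1, sub_self]))
      exact (natDegree_sub_le _ _).trans_lt (max_lt (natDegree_map_le.trans_lt hG) hG)
    have hlift : G ∈ Polynomial.lifts (compRingHom (vanishingPoly U)) := by
      rw [lifts_iff_coeff_lifts]
      intro i
      obtain ⟨M, hM⟩ := exists_eq_comp_vanishingPoly U (G.coeff i) fun w hw x => by
        have h1 := congrArg (fun P => (P.coeff i).eval x) (hinv ⟨w, hw⟩)
        simp only [coeff_map] at h1
        rw [← taylor_eval]
        exact h1
      exact ⟨M, hM.symm⟩
    obtain ⟨G', rfl⟩ := (mem_lifts _).mp hlift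
    exact ⟨AdjoinRoot.mk _ G', R.pointHom_mk R₁ (vanishingAdditivePoly U) h G'⟩

open AlgebraicGeometry CategoryTheory

include hΔ in
/-- The morphism `π` identifies `C_{R₁}` with the quotient of `C_R` by the image of `U`. -/
theorem exists_quotient_iso
    (hpi : X * R.poly = (vanishingAdditivePoly U).poly *
      R₁.poly.comp (vanishingAdditivePoly U).poly + Δ ^ p - Δ) :
    ∃ φ : R.quotient p (R.isotropicSection hp2 hUV hU).range ≅ R₁.curve p,
      φ.hom ≫ R₁.curveStr p = R.quotientStr p _ ∧
        R.quotientMap p _ ≫ φ.hom = R.piMap p R₁ (vanishingAdditivePoly U) Δ hpi := by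
  have hst : (R.aC p - aeval (R.xC p) Δ) ^ p - (R.aC p - aeval (R.xC p) Δ) =
      aeval (R.xC p) (vanishingAdditivePoly U).poly *
        aeval (aeval (R.xC p) (vanishingAdditivePoly U).poly) R₁.poly := by
    have : (R.shiftHom p Δ) (X ^ p - X - C ((vanishingAdditivePoly U).poly *
        R₁.poly.comp (vanishingAdditivePoly U).poly)) = 0 :=
      (R.shiftHom_eq_zero_iff hpi _).mpr dvd_rfl
    rw [map_sub (R.shiftHom p Δ), map_sub (R.shiftHom p Δ), map_pow (R.shiftHom p Δ), shiftHom_X,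
      shiftHom_C, map_mul (aeval (R.xC p)), aeval_comp] at this
    exact sub_eq_zero.mp this
  let G := (R.isotropicSection hp2 hUV hU).range
  let ψ : CoordRing p R₁ →ₐ[F] R.invariants p G :=
    (R₁.pointHom p _ _ hst).codRestrict _ fun y => by
      rw [← R.pointHom_range hp2 R₁ hUV hU hpi hΔ hst]
      exact ⟨y, rfl⟩
  have hψ : Function.Bijective ψ := by
    refine ⟨fun y y' hy => R.pointHom_injective R₁ hpi hst (congrArg Subtype.val hy), fun z => ?_⟩
    obtain ⟨y, hy⟩ := (R.pointHom_range hp2 R₁ hUV hU hpi hΔ hst).ge z.2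
    exact ⟨y, Subtype.ext hy⟩
  let ε : CoordRing p R₁ ≃+* R.invariants p G := RingEquiv.ofBijective ψ hψ
  refine ⟨Scheme.Spec.mapIso ε.toCommRingCatIso.op, ?_, ?_⟩
  · change Spec.map (CommRingCat.ofHom ε.toRingHom) ≫ Spec.map _ = Spec.map _
    rw [← Spec.map_comp]
    congr 1
    ext y
    exact congrArg Subtype.val (ψ.commutes y)
  · change Spec.map _ ≫ Spec.map (CommRingCat.ofHom ε.toRingHom) = Spec.map _
    rw [← Spec.map_comp]
    rfl

end AdditivePoly

/-! ### Equivariance of the vanishing polynomial -/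

section

variable {p : ℕ} [hp : Fact p.Prime] {F : Type u} [Field F] [CharP F p] [Algebra (ZMod p) F]
  (U : Submodule (ZMod p) F) [Fintype U]

/-- If `U` is stable under multiplication by `α`, then `r(α x) = α ^ #U r(x)`, and comparison of the
coefficients of `x`, which are non-zero, gives `α ^ #U = α`. -/
theorem vanishingPoly_comp_C_mul_X [Infinite F] {α : F} (hα : ∀ x ∈ U, α * x ∈ U) :
    (vanishingPoly U).comp (C α * X) = C α * vanishingPoly U := by
  rcases eq_or_ne α 0 with rfl | h0
  · simp [(vanishingPoly_eval_eq_zero_iff U 0).mpr U.zero_mem]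
  let m : U → U := fun u => ⟨α * u, hα u u.2⟩
  have hm : Function.Bijective m := Finite.injective_iff_bijective.mp fun u v huv =>
    Subtype.ext (mul_left_cancel₀ h0 (congrArg Subtype.val huv))
  have h1 : (vanishingPoly U).comp (C α * X) = C (α ^ Fintype.card U) * vanishingPoly U := by
    rw [vanishingPoly, prod_comp, ← Fintype.prod_bijective m hm (fun u => C α * (X - C (u : F))),
      Finset.prod_mul_distrib, Finset.prod_const, Finset.card_univ, C_pow]
    intro u
    simp only [m, sub_comp, X_comp, C_comp]
    rw [C_mul]
    ring
  have h2 : (vanishingPoly U).coeff 1 ≠ 0 :=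
    (vanishingAdditivePoly U).coeff_one_ne_zero_of_separable p (vanishingPoly_separable U) (by
      change (vanishingPoly U).natDegree ≠ 0
      rw [vanishingPoly_natDegree]
      exact Fintype.card_ne_zero)
  have h3 := congrArg (fun P => P.coeff 1) h1
  simp only [comp_C_mul_X_coeff, coeff_C_mul, pow_one] at h3
  rw [h1, mul_left_cancel₀ h2 (by rw [h3, mul_comm] : _ * α ^ Fintype.card U = _ * α)]

theorem mem_range_algebraMap_of_pow_card_eq {k : Type v} [Field k] [Finite k] [Algebra k F] {x : F}
    (hx : x ^ Nat.card k = x) : x ∈ (algebraMap k F).range := by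
  have := Fintype.ofFinite k
  rw [Nat.card_eq_fintype_card] at hx
  have hmon : (X ^ Fintype.card k - X : k[X]).Monic :=
    monic_X_pow_sub (by rw [degree_X]; exact_mod_cast Fintype.one_lt_card)
  have h1 := prod_multiset_X_sub_C_of_monic_of_roots_card_eq hmon (by
    rw [FiniteField.roots_X_pow_card_sub_X,
      FiniteField.X_pow_card_sub_X_natDegree_eq k Fintype.one_lt_card]
    rfl)
  rw [FiniteField.roots_X_pow_card_sub_X] at h1
  have h2 := congrArg (aeval x) h1
  rw [map_sub, map_pow, aeval_X, hx, sub_self] at h2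
  change aeval x (∏ a : k, (X - C a)) = 0 at h2
  rw [map_prod, Finset.prod_eq_zero_iff] at h2
  obtain ⟨a, -, ha⟩ := h2
  refine ⟨a, ?_⟩
  rw [map_sub, aeval_X, aeval_C, sub_eq_zero] at ha
  exact ha.symm

/-- If `U` is stable under the Frobenius map of the finite field `k`, then its vanishing polynomial
has coefficients in `k`. -/
theorem vanishingPoly_mem_lifts {k : Type v} [Field k] [Finite k] [Algebra k F]
    (hU : ∀ x ∈ U, x ^ Nat.card k ∈ U) :
    vanishingPoly U ∈ Polynomial.lifts (algebraMap k F) := by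
  have := Fintype.ofFinite k
  let φ : F →+* F := (FiniteField.frobeniusAlgHom k F).toRingHom
  have hφ : ∀ x, φ x = x ^ Nat.card k := fun x => by
    rw [Nat.card_eq_fintype_card]
    rfl
  let m : U → U := fun u => ⟨φ u, by rw [hφ]; exact hU u u.2⟩
  have hm : Function.Bijective m := Finite.injective_iff_bijective.mp fun u v huv =>
    Subtype.ext (φ.injective (congrArg Subtype.val huv))
  have h1 : (vanishingPoly U).map φ = vanishingPoly U := by
    rw [vanishingPoly, Polynomial.map_prod]
    exact Fintype.prod_bijective m hm _ _ fun u => by simp [m]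
  rw [lifts_iff_coeff_lifts]
  intro i
  apply mem_range_algebraMap_of_pow_card_eq
  rw [← hφ, ← coeff_map, h1]

end

namespace AdditivePoly

variable {p : ℕ} [hp : Fact p.Prime] {F : Type u} [Field F] [CharP F p]

theorem e_eq_of_natDegree {R : AdditivePoly F} {e : ℕ} (he : R.poly.natDegree = p ^ e) :
    R.e p = e := by
  rw [AdditivePoly.e, he, Nat.log_pow hp.out.one_lt]

/-- The polynomial `E_R` is non-zero, as its coefficient of `x` is `a_e`, or `2 a_0` if `e = 0`. -/
theorem E_ne_zero (hp2 : p ≠ 2) {R : AdditivePoly F} (hR : R.poly ≠ 0) : R.E p ≠ 0 := by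
  have h2 := two_ne_zero_of_charP hp2 F
  obtain ⟨e, he⟩ := R.exists_natDegree_eq_pow p hR
  have ha : R.poly.coeff (p ^ e) ≠ 0 := by
    rw [← he]
    exact leadingCoeff_ne_zero.mpr hR
  intro h
  have h1 := congrArg (fun P => derivative P) h
  simp only [E, e_eq_of_natDegree he, derivative_add, derivative_sum, derivative_zero,
    Finset.sum_range_succ, Nat.sub_self, pow_zero, pow_one, derivative_C_mul_X] at h1
  rw [Finset.sum_eq_zero, zero_add] at h1
  · rcases Nat.eq_zero_or_pos e with rfl | hpos
    · rw [pow_zero, pow_one, R.derivative_poly p, ← C_add, C_eq_zero, a, pow_zero] at h1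
      rw [pow_zero] at ha
      exact mul_ne_zero h2 ha (by rw [two_mul]; exact h1)
    · rw [derivative_pow, Nat.cast_pow, CharP.cast_eq_zero, zero_pow hpos.ne', C_0, zero_mul,
        zero_mul, zero_add, C_eq_zero] at h1
      exact ha h1
  · intro i hi
    rw [Finset.mem_range] at hi
    rw [derivative_pow, Nat.cast_pow, CharP.cast_eq_zero, zero_pow (by omega), C_0, zero_mul,
        zero_mul]

theorem finite_V [Algebra (ZMod p) F] (hp2 : p ≠ 2) {R : AdditivePoly F} (hR : R.poly ≠ 0) :
    Finite (R.V p) := by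
  refine (Set.Finite.subset ((R.E p).rootSet_finite F) fun x hx => ?_ : (R.V p : Set F).Finite)
  exact (mem_rootSet_of_ne (E_ne_zero hp2 hR)).mpr hx

/-- For `e = 0` the polynomial `E_R = 2 a_0 x` has no zero except `0`. -/
theorem V_eq_bot [Algebra (ZMod p) F] (hp2 : p ≠ 2) {R : AdditivePoly F}
    (hR : R.poly.natDegree = 1) : R.V p = ⊥ := by
  have h2 := two_ne_zero_of_charP hp2 F
  have he : R.e p = 0 := e_eq_of_natDegree (by rw [hR, pow_zero])
  have ha : R.a p 0 ≠ 0 := by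
    rw [a, pow_zero, ← hR]
    exact leadingCoeff_ne_zero.mpr (ne_zero_of_natDegree_gt (n := 0) (by omega))
  rw [eq_bot_iff]
  intro x hx
  have hx' : aeval x (R.E p) = 0 := hx
  have h1 := R.aeval_eq_sum p x
  rw [he] at h1
  simp only [E, he, map_add, map_pow, h1] at hx'
  simp at hx'
  have h3 : 2 * (R.a p 0 * x) = 0 := by linear_combination hx'
  simpa [h2, ha] using h3

end AdditivePoly

theorem mainTheorem7 {p : ℕ} [Fact p.Prime] (hp2 : p ≠ 2)
    {k : Type v} [Field k] [Finite k] [CharP k p]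
    {F : Type u} [Field F] [CharP F p] [Algebra (ZMod p) F] [Algebra k F] [IsAlgClosure k F]
    (R : AdditivePoly k) (e : ℕ) (he : R.poly.natDegree = p ^ e)
    (m : ℕ) (hm0 : 0 < m) (hm : m.Coprime p)
    (hR : ¬ (R.baseChange F).IsCompletelyAnisotropic p (Nat.card k) m) :
    -- there is a non-zero totally isotropic submodule, and for each such `U` :
    (∃ U : Submodule (ZMod p) F, (R.baseChange F).IsHSubmodule p (Nat.card k) m U ∧ U ≠ ⊥ ∧
      (R.baseChange F).IsTotallyIsotropic p U) ∧
    ∀ U : Submodule (ZMod p) F, (R.baseChange F).IsHSubmodule p (Nat.card k) m U → U ≠ ⊥ →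
      (R.baseChange F).IsTotallyIsotropic p U →
    -- `U` is the zero set of a monic reduced additive polynomial `r` over `𝔽_q`
    ∃ r : AdditivePoly F, r.poly.Monic ∧ IsReduced (F[X] ⧸ Ideal.span {r.poly}) ∧
      (∀ x : F, x ∈ U ↔ r.poly.eval x = 0) ∧
      (∀ α : F, α ^ (R.baseChange F).dm p m = 1 → r.poly.comp (C α * X) = C α * r.poly) ∧
      r.poly ∈ Polynomial.lifts (algebraMap k F) ∧
    ∃ e' : ℕ, e' < e ∧ r.poly.natDegree = p ^ (e - e') ∧ Module.finrank (ZMod p) U = e - e' ∧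
    -- for each basis `β_i` of `U` and the elements `g_i = (1, β_i, f_R(β_i, β_i) / 2)` of `H_R`
    ∀ (b : Module.Basis (Fin (e - e')) (ZMod p) U)
      (g : Fin (e - e') → AdditivePoly.H p (R.baseChange F)),
      (∀ i, (g i).β = (b i : F) ∧
        (g i).γ = (R.baseChange F).f p (b i : F) (b i : F) / 2) →
    -- the product `U' = U_1 ⋯ U_{e-e'}` is an abelian subgroup of `H_R`
    ∃ U' : Subgroup (AdditivePoly.H p (R.baseChange F)),
      (U' : Set (AdditivePoly.H p (R.baseChange F))) =
        (List.ofFn fun i => AdditivePoly.H.line (g i)).prod ∧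
      (∀ x ∈ U', ∀ y ∈ U', x * y = y * x) ∧
    ∃ (R₁ : AdditivePoly F) (Δ : F[X]), R₁.poly.natDegree = p ^ e' ∧ Δ.eval 0 = 0 ∧
      -- the isomorphism `C_R / U' ≅ C_{R₁}` over `F` induced by `π`
      (∃ (h : X * (R.baseChange F).poly =
            r.poly * R₁.poly.comp r.poly + Δ ^ p - Δ)
          (φ : CategoryTheory.Iso ((R.baseChange F).quotient p U') (R₁.curve p)),
        CategoryTheory.CategoryStruct.comp φ.hom (R₁.curveStr p) =
            (R.baseChange F).quotientStr p U' ∧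
          CategoryTheory.CategoryStruct.comp ((R.baseChange F).quotientMap p U') φ.hom =
            (R.baseChange F).piMap p R₁ r Δ h) ∧
      (R.baseChange F).dm p m ∣ R₁.d p := by
  have : IsAlgClosed F := IsAlgClosure.isAlgClosed k
  have : Infinite F := IsAlgClosed.instInfinite
  refine ⟨not_not.mp hR, fun U hUH hU0 hUiso => ?_⟩
  have hSdeg : (R.baseChange F).poly.natDegree = p ^ e := by
    rw [← he]
    exact natDegree_map _
  clear hR
  generalize R.baseChange F = S at *
  have hS0 : S.poly ≠ 0 := ne_zero_of_natDegree_gt (n := 0) (by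
    rw [hSdeg]
    exact pow_pos (Fact.out : p.Prime).pos _)
  have he0 : e ≠ 0 := by
    rintro rfl
    exact hU0 (eq_bot_iff.mpr (hUH.le_V.trans
      (AdditivePoly.V_eq_bot hp2 (by rw [hSdeg, pow_zero])).le))
  have : Finite (S.V p) := AdditivePoly.finite_V hp2 hS0
  have : Finite U := Finite.of_injective _ (Submodule.inclusion_injective hUH.le_V)
  have := Fintype.ofFinite U
  have : Module.Finite (ZMod p) U := Module.Finite.of_finite
  let r : AdditivePoly F := vanishingAdditivePoly U
  have hrdeg : r.poly.natDegree = p ^ Module.finrank (ZMod p) U := by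
    change (vanishingPoly U).natDegree = _
    rw [vanishingPoly_natDegree, Module.card_eq_pow_finrank (K := ZMod p), ZMod.card]
  have hn : Module.finrank (ZMod p) U ≠ 0 := by
    rwa [Ne, Submodule.finrank_eq_zero]
  have hscale : ∀ α : F, α ^ S.dm p m = 1 → r.poly.comp (C α * X) = C α * r.poly :=
    fun α hα => vanishingPoly_comp_C_mul_X U (hUH.mul_mem α hα)
  obtain ⟨R₁, Δ, hΔ0, hdesc, hΔ⟩ := S.exists_descent hp2 hUH.le_V hUiso
  obtain ⟨e', hR₁, hee'⟩ := AdditivePoly.natDegree_descent (r := r) hp2 (vanishingPoly_monic U)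
    (vanishingPoly_separable U) hn hrdeg he0 hSdeg hdesc
  have hsub : e - e' = Module.finrank (ZMod p) U := by omega
  have hred : IsReduced (F[X] ⧸ Ideal.span {r.poly}) := by
    rw [← Ideal.isRadical_iff_quotient_reduced, ← isRadical_iff_span_singleton]
    exact (vanishingPoly_separable U).squarefree.isRadical
  refine ⟨r, vanishingPoly_monic U, hred, fun x => (vanishingPoly_eval_eq_zero_iff U x).symm,
    hscale, vanishingPoly_mem_lifts U hUH.frob_mem, e', by omega, by rw [hsub, hrdeg], hsub.symm,
    fun b g hg => ?_⟩
  refine ⟨(S.isotropicSection hp2 hUH.le_V hUiso).range,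
      S.coe_range_isotropicSection hp2 hUH.le_V hUiso b hg, ?_, ?_⟩
  · rintro _ ⟨u, rfl⟩ _ ⟨v, rfl⟩
    rw [← map_mul, mul_comm, map_mul]
  refine ⟨R₁, Δ, hR₁, hΔ0, ⟨hdesc, ?_⟩, ?_⟩
  · exact S.exists_quotient_iso hp2 R₁ hUH.le_V hUiso hΔ hdesc
  · exact AdditivePoly.dm_dvd_d_of_descent (r := r) hp2 (vanishingPoly_monic U)
      (vanishingPoly_separable U) hn hrdeg he0 hSdeg hscale hdesc
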